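/- Let $n\ge 1$, let $D_1,\dots,D_n$ be probability distributions on $\mathbb{R}^p$, let $F_i:\mathbb{R}^d\times\mathbb{R}^p\to\mathbb{R}$, $f_i(x)=\mathbb{E}_{\xi\sim D_i}F_i(x,\xi)$, $f=\frac1n\sum_{i=1}^n f_i$, $f^\star=\inf_x f(x)$ and $\tilde f=f-f^\star$; $\nabla F_i$ is the gradient in $x$. Let $W=(w_{ij})\in\mathbb{R}^{n\times n}$, $\alpha>0$, $\beta\in[0,1)$, $x^{(0)}\in\mathbb{R}^d$, and let $\xi_i^{(t)}$ ($1\le i\le n$, $t\ge 0$) be random vectors in $\mathbb{R}^p$. The algorithm EDM starts from $x_i^{(-1)}=x_i^{(0)}=x^{(0)}$, $m_i^{(-1)}=0$, $\psi_i^{(0)}=x^{(0)}$ and iterates, for $t\ge0$ and $1\le i\le n$, $$m_i^{(t)}=\beta m_i^{(t-1)}+(1-\beta)\nabla F_i(x_i^{(t)},\xi_i^{(t)}),\quad \psi_i^{(t+1)}=x_i^{(t)}-\alpha m_i^{(t)},\quad \phi_i^{(t+1)}=\psi_i^{(t+1)}+x_i^{(t)}-\psi_i^{(t)},\quad x_i^{(t+1)}=\sum_{j=1}^n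 w_{ij}\phi_j^{(t+1)}.$$ Put $\bar x^{(t)}=\frac1n\sum_i x_i^{(t)}$ and $\lambda=\|W-\frac1n\mathbf 1\mathbf 1^\top\|_{\mathrm{op}}$. Assume: 1. $W$ has nonnegative entries and positive diagonal, is symmetric and doubly stochastic, and all its eigenvalues are positive. 2. Every $f_i$ is differentiable with $L$-Lipschitz gradient, $L>0$, and bounded from below. 3. The $\xi_i^{(t)}$ are independent over all $i$ and $t$, $\xi_i^{(t)}\sim D_i$, and with $\mathcal F^{(t)}$ the $\sigma$-algebra generated by $\xi_i^{(s)}$, $s<t$, $1\le i\le n$, the noise $\delta_i^{(t)}=\nabla F_i(x_i^{(t)},\xi_i^{(t)})-\nabla f_i(x_i^{(t)})$ satisfies $\mathbb{E}[\delta_i^{(t)}\mid\mathcal F^{(t)}]=0$ and $\mathbb{E}[\|\delta_i^{(t)}\|^2\mid\mathcal F^{(t)}]\le\sigma^2$. 4. $\mu>0$ and $2\mu(f(x)-f^\star)\le\|\nabla f(x)\|^2$ for all $x\in\mathbb{R}^d$ (and $\alpha\mu\le 1$, which is automatic unless $f$ is constant). Suppose $\alpha\le\min\left\{\frac{1-\sqrt\lambda}{10L},\frac{1-\beta}{5L}\right\}$.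 Let $\zeta_0^2=\frac1n\sum_{i=1}^n\|\nabla f_i(x^{(0)})-\nabla f(x^{(0)})\|^2$, $\rho_1=1-\alpha\mu$, $\rho_2=1-\min\left\{\frac{1-\sqrt\lambda}{5},\frac{2(1-\beta)}{5}\right\}$, $$D_1=\frac{50\lambda\beta^2}{3(1-\beta)}+\frac{320(1-\beta)^2}{3(1+\sqrt\lambda)}+\frac{160}{3}\lambda\beta^2(1-\sqrt\lambda),\qquad D_2=\frac{100}{3}\left(\frac{5\lambda\beta^2}{3(1-\beta)}+4(1-\beta)^2+2\lambda\beta^2(1-\lambda)\right).$$ Then $\rho_1,\rho_2\in[0,1)$, and for every $t\ge0$ the random variable $\tilde f(\bar x^{(t)})$ is integrable and $$\mathbb{E}\,\tilde f(\bar x^{(t)})\le\left(9\tilde f(x^{(0)})+\frac{D_1\alpha^3L^2\zeta_0^2}{(1-\sqrt\lambda)^2}\right)\rho_1^t+\frac{D_2\alpha^2L\zeta_0^2}{1-\lambda}\rho_2^t+\frac{6\alpha L\sigma^2}{n\mu}+\frac{169\alpha^2L^2\lambda^2\sigma^2}{\mu(1-\lambda)}.$$ So EDM converges linearly, in expected optimality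 gap, to a neighborhood whose radius does not depend on the data heterogeneity $\zeta_0$. -/

import Mathlib

open MeasureTheory ProbabilityTheory

noncomputable section

namespace EDM

/-- `ℝᵈ` with the Euclidean norm. -/
abbrev Vec (d : ℕ) := EuclideanSpace ℝ (Fin d)

/-- The mean `(1/n) ∑ᵢ vᵢ` of the vectors held by `n` agents. -/
def avg {n d : ℕ} (v : Fin n → Vec d) : Vec d := (n : ℝ)⁻¹ • ∑ i, v i

/-- Conditions on the communication matrix `W`. The edges of the network are the pairs `(i, j)`
with `W i j ≠ 0`, so `nonneg` says that the weight is positive on edges and zero elsewhere. -/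
structure IsCommunicationMatrix {n : ℕ} (W : Matrix (Fin n) (Fin n) ℝ) : Prop where
  nonneg : ∀ i j, 0 ≤ W i j
  diag_pos : ∀ i, 0 < W i i
  symm : W.IsSymm
  row_sum : ∀ i, ∑ j, W i j = 1
  col_sum : ∀ j, ∑ i, W i j = 1
  eigenvalue_pos : ∀ c : ℝ, Module.End.HasEigenvalue (Matrix.toLin' W) c → 0 < c

/-- The averaging matrix `(1/n) 1 1ᵀ`. -/
def avgMatrix (n : ℕ) : Matrix (Fin n) (Fin n) ℝ := Matrix.of fun _ _ => (n : ℝ)⁻¹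

/-- `λ = ‖W - (1/n) 1 1ᵀ‖` in the spectral norm. -/
def mixingRate {n : ℕ} (W : Matrix (Fin n) (Fin n) ℝ) : ℝ :=
  ‖Matrix.toEuclideanCLM (n := Fin n) (𝕜 := ℝ) (W - avgMatrix n)‖

/-- The local objective `fᵢ(x) = E_{s ∼ Dᵢ} Fᵢ(x, s)`. -/
def localObj {n d p : ℕ} (F : Fin n → Vec d → Vec p → ℝ) (D : Fin n → Measure (Vec p))
    (i : Fin n) (x : Vec d) : ℝ := ∫ s, F i x s ∂(D i)

/-- The global objective `f = (1/n) ∑ᵢ fᵢ`. -/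
def globalObj {n d : ℕ} (f : Fin n → Vec d → ℝ) (x : Vec d) : ℝ := (n : ℝ)⁻¹ * ∑ i, f i x

/-- The stochastic gradient `∇Fᵢ(x, s)`, the gradient being taken in `x`. -/
def stochGrad {n d p : ℕ} (F : Fin n → Vec d → Vec p → ℝ)
    (i : Fin n) (x : Vec d) (s : Vec p) : Vec d := gradient (fun y => F i y s) x

/-- The losses are such that `fᵢ` and `∇Fᵢ` make sense: `Fᵢ(x, ·)` is integrable,
`Fᵢ(·, s)` is differentiable at `x` for almost every `s`, and `∇Fᵢ` is (jointly) measurable. -/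
structure WellPosed {n d p : ℕ} (F : Fin n → Vec d → Vec p → ℝ)
    (D : Fin n → Measure (Vec p)) : Prop where
  integrable : ∀ i x, Integrable (F i x) (D i)
  differentiable : ∀ i x, ∀ᵐ s ∂(D i), DifferentiableAt ℝ (fun y => F i y s) x
  measurable_grad : ∀ i, Measurable fun q : Vec d × Vec p => stochGrad F i q.1 q.2

/-- Every `fᵢ` is differentiable with `L`-Lipschitz gradient and bounded from below. -/
structure IsSmoothFamily {n d : ℕ} (f : Fin n → Vec d → ℝ) (L : ℝ) : Prop where
  differentiable : ∀ i, Differentiable ℝ (f i)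
  lipschitz : ∀ i x y, ‖gradient (f i) x - gradient (f i) y‖ ≤ L * ‖x - y‖
  bddBelow : ∀ i, BddBelow (Set.range (f i))

/-- The optimal value `f⋆` of an objective. -/
def optValue {d : ℕ} (f : Vec d → ℝ) : ℝ := ⨅ x, f x

/-- The optimality gap `f̃ = f - f⋆`. -/
def gap {d : ℕ} (f : Vec d → ℝ) (x : Vec d) : ℝ := f x - optValue f

/-- The Polyak–Łojasiewicz inequality with constant `μ`. -/
def PLCondition {d : ℕ} (f : Vec d → ℝ) (μ : ℝ) : Prop :=
  ∀ x, 2 * μ * (f x - optValue f) ≤ ‖gradient f x‖ ^ 2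

/-- The variables of all agents: at time `t`, the parameters `x⁽ᵗ⁾`, the adapted parameters
`ψ⁽ᵗ⁾` and the momenta `m⁽ᵗ⁻¹⁾`. -/
structure State (n d : ℕ) where
  x : Fin n → Vec d
  ψ : Fin n → Vec d
  m : Fin n → Vec d

/-- One iteration of Exact-Diffusion with Momentum, from the local stochastic gradients `g`. -/
def step {n d : ℕ} (W : Matrix (Fin n) (Fin n) ℝ) (α β : ℝ) (g : Fin n → Vec d)
    (S : State n d) : State n d :=
  let m' : Fin n → Vec d := fun i => β • S.m i + (1 - β) • g i
  let ψ' : Fin n → Vec d := fun i => S.x i - α • m' i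
  let φ : Fin n → Vec d := fun i => ψ' i + S.x i - S.ψ i
  { x := fun i => ∑ j, W i j • φ j, ψ := ψ', m := m' }

/-- The run of Exact-Diffusion with Momentum on the data `z i t` (agent `i`, time `t`), with
`x⁽⁻¹⁾ = x⁽⁰⁾ = x₀` at every agent and `m⁽⁻¹⁾ = 0`, so that `ψ⁽⁰⁾ = x₀`. -/
def run {n d p : ℕ} (W : Matrix (Fin n) (Fin n) ℝ) (α β : ℝ)
    (F : Fin n → Vec d → Vec p → ℝ) (x₀ : Vec d) (z : Fin n → ℕ → Vec p) : ℕ → State n d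
  | 0 => { x := fun _ => x₀, ψ := fun _ => x₀, m := fun _ => 0 }
  | t + 1 =>
      let S := run W α β F x₀ z t
      step W α β (fun i => stochGrad F i (S.x i) (z i t)) S

/-- The iterate `xᵢ⁽ᵗ⁾` as a random vector, for random data `ξ`. -/
def iterate {Ω : Type*} {n d p : ℕ} (W : Matrix (Fin n) (Fin n) ℝ) (α β : ℝ)
    (F : Fin n → Vec d → Vec p → ℝ) (x₀ : Vec d) (ξ : Fin n → ℕ → Ω → Vec p)
    (t : ℕ) (i : Fin n) (ω : Ω) : Vec d :=
  (run W α β F x₀ (fun j s => ξ j s ω) t).x i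

/-- `ℱ⁽ᵗ⁾`, generated by the data of all agents at the times `0, …, t - 1`. -/
abbrev past {Ω : Type*} {n p : ℕ} (ξ : Fin n → ℕ → Ω → Vec p) (t : ℕ) : MeasurableSpace Ω :=
  ⨆ (s : ℕ) (_ : s < t) (i : Fin n), MeasurableSpace.comap (ξ i s) inferInstance

/-- The data `ξᵢ⁽ᵗ⁾` are independent over all `i` and `t`, and `ξᵢ⁽ᵗ⁾` has law `Dᵢ`. -/
structure IsDataStream {Ω : Type*} [MeasurableSpace Ω] {n p : ℕ} (P : Measure Ω)
    (D : Fin n → Measure (Vec p)) (ξ : Fin n → ℕ → Ω → Vec p) : Prop where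
  measurable : ∀ i t, Measurable (ξ i t)
  law : ∀ i t, P.map (ξ i t) = D i
  indep : iIndepFun (fun q : Fin n × ℕ => ξ q.1 q.2) P

/-- Unbiasedness and bounded variance, conditionally on the past, of the stochastic gradients
at the random vectors `X t i`. Square integrability is stated so that the conditional
expectations are the genuine ones. -/
structure IsUnbiasedWithVariance {Ω : Type*} [MeasurableSpace Ω] {n d p : ℕ} (P : Measure Ω)
    (F : Fin n → Vec d → Vec p → ℝ) (f : Fin n → Vec d → ℝ) (ξ : Fin n → ℕ → Ω → Vec p)
    (X : ℕ → Fin n → Ω → Vec d) (σ : ℝ) : Prop where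
  memLp : ∀ t i,
    MemLp (fun ω => stochGrad F i (X t i ω) (ξ i t ω) - gradient (f i) (X t i ω)) 2 P
  unbiased : ∀ t i,
    P[fun ω => stochGrad F i (X t i ω) (ξ i t ω) - gradient (f i) (X t i ω) | past ξ t] =ᵐ[P] 0
  variance_le : ∀ t i,
    P[fun ω => ‖stochGrad F i (X t i ω) (ξ i t ω) - gradient (f i) (X t i ω)‖ ^ 2 | past ξ t]
      ≤ᵐ[P] fun _ => σ ^ 2

/-- The initial heterogeneity
`ζ₀² = (1/n) ‖(I - (1/n) 1 1ᵀ) ∇𝐟(X⁽⁰⁾)‖_F² = (1/n) ∑ᵢ ‖∇fᵢ(x₀) - (1/n) ∑ⱼ ∇fⱼ(x₀)‖²`. -/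
def heterogeneitySq {n d : ℕ} (f : Fin n → Vec d → ℝ) (x₀ : Vec d) : ℝ :=
  (n : ℝ)⁻¹ * ∑ i, ‖gradient (f i) x₀ - avg (fun j => gradient (f j) x₀)‖ ^ 2

/-- The constant `D₁`, with `l` for `λ`. -/
def constD₁ (l β : ℝ) : ℝ :=
  50 * l * β ^ 2 / (3 * (1 - β)) + 320 * (1 - β) ^ 2 / (3 * (1 + √l))
    + 160 / 3 * l * β ^ 2 * (1 - √l)

/-- The constant `D₂`, with `l` for `λ`. -/
def constD₂ (l β : ℝ) : ℝ :=
  100 / 3 * (5 * l * β ^ 2 / (3 * (1 - β)) + 4 * (1 - β) ^ 2 + 2 * l * β ^ 2 * (1 - l))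

/-- The rate `ρ₁ = 1 - α μ`. -/
def rate₁ (α μ : ℝ) : ℝ := 1 - α * μ

/-- The rate `ρ₂ = 1 - min {(1 - √λ)/5, 2(1 - β)/5}`, with `l` for `λ`. -/
def rate₂ (l β : ℝ) : ℝ := 1 - min ((1 - √l) / 5) (2 * (1 - β) / 5)

end EDM

end

namespace EDM

/-! ### Energy of a single consensus mode; momentum as smoothing -/

section Deterministic

variable {E : Type*} [NormedAddCommGroup E] [InnerProductSpace ℝ E]

set_option linter.unusedSectionVars false

local notation "⟪" x ", " y "⟫" => inner ℝ x y

/-! One Lyapunov function contracts in expectation by `1 - α μ` per iteration, up to a variance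
term, and twice it dominates the optimality gap at the mean.

Averaging over the agents removes the network: `z = x̄ - (αβ/(1-β)) m̄` obeys `z' = z - α (g + δ)`,
where `g` is the average of the local gradients at the agents' own points. The descent lemma and the
PL inequality at `z` give the decay, at the price of `‖m̄‖²` and of the consensus error
(`IsSmoothObjective.mean_step_le`).

Diagonalizing `W - (1/n) 1 1ᵀ` splits the disagreement into modes with eigenvalues `b ∈ [0, λ]`. In
each mode the algorithm is the exponential smoothing, with parameter `β`, of momentum-free
Exact-Diffusion driven by the same gradients (`mode_eq_smoothing`), so the energy of a mode can be
studied without momentum. Undriven, this energy decays by the factor `(1 + b)/2`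
(`stepEnergy_smul_le`). Shifting the second variable `s` by `α` times the mode of the local
gradients at `x̄` absorbs the heterogeneity: only differences of a gradient `∇fᵢ` between two
points, and noise, still drive the energy (`sum_modeEnergy_step_le`). Hence `ζ₀` enters through the
initial energy alone.

The weights in `lyapunov` make every square produced by one part payable by the margin of another
(`lyapunov_step_le`). To first order the noise is paired with directions known from the past and
integrates to zero; to second order, independence across agents gives the averaged noise variance
`σ²/n`. Unrolling the recursion gives a bound with the single rate `ρ₁`; the `ρ₂` term of the
theorem is nonnegative room. -/

theorem sq_norm_add_le_young {τ : ℝ} (hτ : 0 < τ) (x y : E) :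
    ‖x + y‖ ^ 2 ≤ (1 + τ) * ‖x‖ ^ 2 + (1 + 1 / τ) * ‖y‖ ^ 2 := by
  have h1 : ‖x + y‖ ^ 2 ≤ (‖x‖ + ‖y‖) ^ 2 := by gcongr; exact norm_add_le x y
  have h2 : 0 ≤ (τ * ‖x‖ - ‖y‖) ^ 2 / τ := by positivity
  have h3 : (τ * ‖x‖ - ‖y‖) ^ 2 / τ = τ * ‖x‖ ^ 2 - 2 * ‖x‖ * ‖y‖ + 1 / τ * ‖y‖ ^ 2 := by
    field_simp
    ring
  nlinarith

theorem sq_norm_convex_comb_le {β : ℝ} (hβ₀ : 0 ≤ β) (hβ₁ : β ≤ 1) (x y : E) :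
    ‖β • x + (1 - β) • y‖ ^ 2 ≤ β * ‖x‖ ^ 2 + (1 - β) * ‖y‖ ^ 2 := by
  have h1 : ‖β • x + (1 - β) • y‖ ^ 2
      = β * ‖x‖ ^ 2 + (1 - β) * ‖y‖ ^ 2 - β * (1 - β) * ‖x - y‖ ^ 2 := by
    rw [norm_add_sq_real, norm_sub_sq_real, norm_smul, norm_smul, inner_smul_left,
      inner_smul_right, mul_pow, mul_pow, Real.norm_eq_abs, Real.norm_eq_abs, sq_abs, sq_abs]
    simp only [conj_trivial]
    ring
  have := mul_nonneg (mul_nonneg hβ₀ (sub_nonneg.2 hβ₁)) (sq_nonneg ‖x - y‖)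
  linarith

/-- The energy of one consensus mode with eigenvalue `b`. -/
noncomputable def modeEnergy (b : ℝ) (φ s : E) : ℝ :=
  (1 + b) / 2 * ‖φ‖ ^ 2 + ‖s‖ ^ 2 / (1 - b)

theorem modeEnergy_nonneg {b : ℝ} (hb₀ : 0 ≤ b) (hb₁ : b < 1) (φ s : E) :
    0 ≤ modeEnergy b φ s := by
  have : 0 < 1 - b := sub_pos.2 hb₁
  unfold modeEnergy
  positivity

/-- The quadratic form `‖w‖² + b/(1-b) ‖s‖² + (1-b)/2 ‖w - s‖²`, which is the energy of the mode
after an undriven step. -/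
noncomputable def stepEnergy (b : ℝ) (w s : E) : ℝ :=
  ‖w‖ ^ 2 + b / (1 - b) * ‖s‖ ^ 2 + (1 - b) / 2 * ‖w - s‖ ^ 2

/-- A driven step has `w = b φ - α g`. In the variables `w` and `s` the gradient perturbs `w` alone.
-/
theorem modeEnergy_step_eq {b : ℝ} (hb₁ : b < 1) (w s : E) :
    modeEnergy b (w - s) (s + (1 - b) • (w - s)) = stepEnergy b w s := by
  have hb : 1 - b ≠ 0 := (sub_pos.2 hb₁).ne'
  unfold modeEnergy stepEnergy
  rw [norm_add_sq_real, norm_smul, inner_smul_right, mul_pow, Real.norm_eq_abs, sq_abs,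
    inner_sub_right, norm_sub_sq_real, real_inner_self_eq_norm_sq, real_inner_comm]
  field_simp
  ring

/-- The slack is an explicit nonnegative combination of `‖φ‖²` and `‖(1-b) φ + s‖²`. -/
theorem stepEnergy_smul_le {b : ℝ} (hb₀ : 0 ≤ b) (hb₁ : b < 1) (φ s : E) :
    stepEnergy b (b • φ) s ≤ (1 + b) / 2 * modeEnergy b φ s := by
  have hb : 0 < 1 - b := sub_pos.2 hb₁
  have h : (1 + b) / 2 * modeEnergy b φ s - stepEnergy b (b • φ) s
      = (1 - b) / 2 * ((1 + b) / 2 * ‖φ‖ ^ 2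
        + b / (1 - b) * ‖(1 - b) • φ + s‖ ^ 2) := by
    unfold modeEnergy stepEnergy
    rw [norm_sub_sq_real, norm_add_sq_real, norm_smul, norm_smul, inner_smul_left, inner_smul_left,
      mul_pow, mul_pow, Real.norm_eq_abs, Real.norm_eq_abs, sq_abs, sq_abs]
    simp only [conj_trivial]
    field_simp
    ring
  have h2 : 0 ≤ (1 - b) / 2 * ((1 + b) / 2 * ‖φ‖ ^ 2
        + b / (1 - b) * ‖(1 - b) • φ + s‖ ^ 2) := by positivity
  linarith


theorem stepEnergy_add_le {b θ : ℝ} (hb₀ : 0 ≤ b) (hb₁ : b < 1) (hθ : 0 < θ) (w v s : E) :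
    stepEnergy b (w + v) s
      ≤ (1 + θ) * stepEnergy b w s + (1 + 1 / θ) * (1 + (1 - b) / 2) * ‖v‖ ^ 2 := by
  have hb : 0 < 1 - b := sub_pos.2 hb₁
  have h1 := sq_norm_add_le_young hθ w v
  have h2 := mul_le_mul_of_nonneg_left (sq_norm_add_le_young hθ (w - s) v)
    (by positivity : 0 ≤ (1 - b) / 2)
  have h3 : 0 ≤ θ * (b / (1 - b) * ‖s‖ ^ 2) := by positivity
  unfold stepEnergy
  rw [show w + v - s = w - s + v by abel]
  linarith

/-- The noise is expanded exactly, not by Young's inequality: its first-order part must remain an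
inner product in order to integrate to zero. -/
theorem stepEnergy_sub_smul (b α : ℝ) (w δ s : E) :
    stepEnergy b (w - α • δ) s = stepEnergy b w s
      + ⟪-(2 * α) • (w + ((1 - b) / 2) • (w - s)), δ⟫ + (1 + (1 - b) / 2) * α ^ 2 * ‖δ‖ ^ 2 := by
  unfold stepEnergy
  rw [show w - α • δ - s = w - s - α • δ by abel, norm_sub_sq_real w, norm_sub_sq_real (w - s),
    norm_smul, inner_smul_right, inner_smul_right, inner_smul_left, inner_add_left,
    inner_smul_left, mul_pow, Real.norm_eq_abs, sq_abs]
  simp only [conj_trivial]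
  ring

theorem modeEnergy_add_le {b τ : ℝ} (hb₀ : 0 ≤ b) (hb₁ : b < 1) (hτ : 0 < τ) (φ s D : E) :
    modeEnergy b φ (s + D) ≤ (1 + τ) * modeEnergy b φ s + (1 + 1 / τ) * ‖D‖ ^ 2 / (1 - b) := by
  have hb : 0 < 1 - b := sub_pos.2 hb₁
  have h1 := div_le_div_of_nonneg_right (sq_norm_add_le_young hτ s D) hb.le
  have h2 : 0 ≤ τ * ((1 + b) / 2 * ‖φ‖ ^ 2) := by positivity
  unfold modeEnergy
  rw [add_div] at h1
  calc _ ≤ _ := add_le_add_right h1 _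
    _ ≤ _ := by
      rw [mul_add, mul_div_assoc (1 + τ)]
      linarith

/-- The direction along which the noise enters the energy of a mode to first order. -/
noncomputable def modeNoiseDir (l α b : ℝ) (φ s ε : E) : E :=
  (1 + (1 - l) / 8) • -(2 * α) • (b • φ - α • ε + ((1 - b) / 2) • (b • φ - α • ε - s))

theorem modeEnergy_step_le {b l α : ℝ} (hb₀ : 0 ≤ b) (hbl : b ≤ l) (hl : l < 1)
    (φ s ε δ D : E) :
    modeEnergy b (b • φ - α • (ε + δ) - s) (s + (1 - b) • (b • φ - α • (ε + δ) - s) + D)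
      ≤ (1 - (1 - l) / 4) * modeEnergy b φ s + 16 / (1 - l) * α ^ 2 * ‖ε‖ ^ 2
        + ⟪modeNoiseDir l α b φ s ε, δ⟫ + 2 * α ^ 2 * ‖δ‖ ^ 2 + 9 / (1 - l) ^ 2 * ‖D‖ ^ 2 := by
  have hb₁ : b < 1 := hbl.trans_lt hl
  have hx : 0 < 1 - b := sub_pos.2 hb₁
  obtain ⟨X, hX⟩ : ∃ X, X = 1 - l := ⟨_, rfl⟩
  have hX0 : 0 < X := by linarith
  have hX1 : X ≤ 1 := by linarith
  have hXb : X ≤ 1 - b := by linarith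
  -- The undriven step leaves a margin of at least `X / 2`. Young's inequality with parameter `X /
  -- 8`, once for `ε` and once for `D`, uses at most half of it.
  have hτ : 0 < X / 8 := by positivity
  have e1 := modeEnergy_add_le hb₀ hb₁ hτ (b • φ - α • (ε + δ) - s)
    (s + (1 - b) • (b • φ - α • (ε + δ) - s)) D
  rw [modeEnergy_step_eq hb₁ (b • φ - α • (ε + δ)) s,
    show b • φ - α • (ε + δ) = (b • φ - α • ε) - α • δ by rw [smul_add]; abel,
    stepEnergy_sub_smul] at e1
  have e2 := stepEnergy_add_le hb₀ hb₁ hτ (b • φ) (-(α • ε)) s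
  have e3 := stepEnergy_smul_le hb₀ hb₁ φ s
  rw [← sub_eq_add_neg, norm_neg, norm_smul, mul_pow, Real.norm_eq_abs, sq_abs] at e2
  have hQ := modeEnergy_nonneg hb₀ hb₁ φ s
  have e4 : (1 + X / 8) * ((1 + X / 8) * ((1 + b) / 2 * modeEnergy b φ s))
      ≤ (1 - X / 4) * modeEnergy b φ s := by
    have : (1 + X / 8) * ((1 + X / 8) * ((1 + b) / 2)) ≤ 1 - X / 4 := by
      have h1 : (1 + b) / 2 ≤ 1 - X / 2 := by linarith
      calc (1 + X / 8) * ((1 + X / 8) * ((1 + b) / 2))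
          ≤ (1 + X / 8) * ((1 + X / 8) * (1 - X / 2)) := by gcongr
        _ ≤ 1 - X / 4 := by nlinarith [pow_pos hX0 2, pow_pos hX0 3]
    calc _ = (1 + X / 8) * ((1 + X / 8) * ((1 + b) / 2)) * modeEnergy b φ s := by ring
      _ ≤ _ := by gcongr
  have e5 : (1 + X / 8) * ((1 + 1 / (X / 8)) * (1 + (1 - b) / 2) * (α ^ 2 * ‖ε‖ ^ 2))
      ≤ 16 / X * α ^ 2 * ‖ε‖ ^ 2 := by
    have h1 : (1 + X / 8) * (1 + 1 / (X / 8)) * (1 + (1 - b) / 2) ≤ 16 / X := by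
      have : (1 + X / 8) * (1 + 1 / (X / 8)) * (1 + (1 - b) / 2)
          ≤ (1 + X / 8) * (1 + 1 / (X / 8)) * (3 / 2) := by gcongr; linarith
      refine this.trans ?_
      rw [le_div_iff₀ hX0]
      field_simp
      nlinarith
    calc _ = (1 + X / 8) * (1 + 1 / (X / 8)) * (1 + (1 - b) / 2) * (α ^ 2 * ‖ε‖ ^ 2) := by ring
      _ ≤ 16 / X * (α ^ 2 * ‖ε‖ ^ 2) := by gcongr
      _ = _ := by ring
  have e6 : (1 + X / 8) * ((1 + (1 - b) / 2) * α ^ 2 * ‖δ‖ ^ 2) ≤ 2 * α ^ 2 * ‖δ‖ ^ 2 := by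
    have h1 : (1 + X / 8) * (1 + (1 - b) / 2) ≤ 2 := by nlinarith
    calc _ = (1 + X / 8) * (1 + (1 - b) / 2) * (α ^ 2 * ‖δ‖ ^ 2) := by ring
      _ ≤ 2 * (α ^ 2 * ‖δ‖ ^ 2) := by gcongr
      _ = _ := by ring
  have e7 : (1 + 1 / (X / 8)) * ‖D‖ ^ 2 / (1 - b) ≤ 9 / X ^ 2 * ‖D‖ ^ 2 := by
    have h1 : (1 + 1 / (X / 8)) / (1 - b) ≤ 9 / X ^ 2 := by
      calc (1 + 1 / (X / 8)) / (1 - b) ≤ (1 + 1 / (X / 8)) / X := by gcongr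
        _ = (X + 8) / X ^ 2 := by field_simp
        _ ≤ 9 / X ^ 2 := by gcongr; linarith
    calc _ = (1 + 1 / (X / 8)) / (1 - b) * ‖D‖ ^ 2 := by ring
      _ ≤ _ := by gcongr
  have e8 := mul_le_mul_of_nonneg_left (e2.trans (add_le_add_left
    (mul_le_mul_of_nonneg_left e3 (by positivity)) _)) (by positivity : 0 ≤ 1 + X / 8)
  rw [show b • φ - α • (ε + δ) = (b • φ - α • ε) - α • δ by rw [smul_add]; abel]
  have e9 : ⟪modeNoiseDir l α b φ s ε, δ⟫ = (1 + X / 8) *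
      ⟪-(2 * α) • (b • φ - α • ε + ((1 - b) / 2) • (b • φ - α • ε - s)), δ⟫ := by
    rw [modeNoiseDir, inner_smul_left, ← hX]
    rfl
  rw [e9, ← hX]
  linarith

/-- The pair `(φ, s)` of a consensus mode with eigenvalue `b`, driven by the gradients `g`. -/
noncomputable def modeRun (b α : ℝ) (g : ℕ → E) : ℕ → E × E
  | 0 => (0, 0)
  | t + 1 =>
      let r := modeRun b α g t
      (b • r.1 - α • g t - r.2, r.2 + (1 - b) • (b • r.1 - α • g t - r.2))

/-- The induction also needs the companion statement that `ψ - x` is the same smoothing of the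
second variable `s`; both recursions are linear with the same coefficients, so smoothing the
gradients smooths the trajectory. -/
theorem mode_eq_smoothing {b α β : ℝ} (x ψ m g : ℕ → E) (hx₀ : x 0 = 0) (hψ₀ : ψ 0 = 0)
    (hm₀ : m 0 = 0) (hm : ∀ t, m (t + 1) = β • m t + (1 - β) • g t)
    (hψ : ∀ t, ψ (t + 1) = x t - α • m (t + 1))
    (hx : ∀ t, x (t + 1) = b • (ψ (t + 1) + x t - ψ t)) (t : ℕ) :
    x (t + 1) = β • x t + (1 - β) • b • (modeRun b α g (t + 1)).1 := by
  suffices h : x (t + 1) = β • x t + (1 - β) • b • (modeRun b α g (t + 1)).1 ∧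
      ψ (t + 1) - x (t + 1) = β • (ψ t - x t) + (1 - β) • (modeRun b α g (t + 1)).2 from h.1
  induction t with
  | zero =>
    have h1 : x 1 = b • -(α • (1 - β) • g 0) := by
      rw [hx 0, hψ 0, hm 0, hx₀, hψ₀, hm₀]
      module
    have h2 : ψ 1 = -(α • (1 - β) • g 0) := by
      rw [hψ 0, hm 0, hx₀, hm₀]
      module
    simp only [zero_add, modeRun, h1, h2, hx₀, hψ₀]
    constructor <;> module
  | succ t ih =>
    obtain ⟨ih1, ih2⟩ := ih
    have h1 : x (t + 2) = β • x (t + 1) + (1 - β) • b • (modeRun b α g (t + 2)).1 := by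
      rw [hx (t + 1), hψ (t + 1), hm (t + 1)]
      simp only [modeRun] at ih1 ih2 ⊢
      linear_combination (norm := module) b • ih1 - b • ih2 - (b * β) • hψ t - β • hx t
    refine ⟨h1, ?_⟩
    have h2 := hψ (t + 1)
    rw [hm (t + 1)] at h2
    simp only [modeRun] at ih1 ih2 h1 h2 ⊢
    linear_combination (norm := module) h2 - h1 + ih1 - β • hψ t

end Deterministic
-- Smooth objectives and the descent of the mean
section Smooth

variable {E : Type*} [NormedAddCommGroup E] [InnerProductSpace ℝ E]

set_option linter.unusedSectionVars false

local notation "⟪" x ", " y "⟫" => inner ℝ x y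

theorem le_quadratic_of_lipschitz_gradient [CompleteSpace E] {f : E → ℝ} {L : ℝ}
    (hf : Differentiable ℝ f) (hL : ∀ x y, ‖gradient f x - gradient f y‖ ≤ L * ‖x - y‖) (x y : E) :
    f y ≤ f x + ⟪gradient f x, y - x⟫ + L / 2 * ‖y - x‖ ^ 2 := by
  set v := y - x with hv
  -- The gap between `f` on the segment and the claimed quadratic bound; the Lipschitz condition
  -- makes its derivative nonpositive.
  let h : ℝ → ℝ := fun s => f (x + s • v) - s * ⟪gradient f x, v⟫ - s ^ 2 * (L / 2 * ‖v‖ ^ 2)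
  have hd : ∀ s, HasDerivAt h
      (⟪gradient f (x + s • v), v⟫ - 1 * ⟪gradient f x, v⟫
        - ((2 : ℕ) * s ^ (2 - 1) * 1) * (L / 2 * ‖v‖ ^ 2)) s := by
    intro s
    have h1 : HasDerivAt (fun s : ℝ => x + s • v) ((1 : ℝ) • v) s :=
      ((hasDerivAt_id s).smul_const v).const_add x
    have h2 := (hf (x + s • v)).hasFDerivAt.comp_hasDerivAt s h1
    rw [one_smul, ← inner_gradient_left] at h2
    exact (h2.sub ((hasDerivAt_id s).mul_const _)).sub (((hasDerivAt_id s).pow 2).mul_const _)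
  have hanti : AntitoneOn h (Set.Icc 0 1) := by
    apply antitoneOn_of_deriv_nonpos (convex_Icc 0 1)
    · exact fun s _ => (hd s).continuousAt.continuousWithinAt
    · exact fun s _ => (hd s).differentiableAt.differentiableWithinAt
    · intro s hs
      rw [interior_Icc] at hs
      rw [(hd s).deriv]
      have h1 : ⟪gradient f (x + s • v) - gradient f x, v⟫ ≤ L * ‖s • v‖ * ‖v‖ := by
        refine (real_inner_le_norm _ _).trans ?_
        gcongr
        simpa using hL (x + s • v) x
      rw [inner_sub_left, norm_smul, Real.norm_eq_abs, abs_of_pos hs.1] at h1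
      simp only [Nat.cast_ofNat, Nat.add_one_sub_one, pow_one, mul_one, one_mul]
      linarith
  have := hanti (Set.left_mem_Icc.2 zero_le_one) (Set.right_mem_Icc.2 zero_le_one) zero_le_one
  simp only [h, one_smul, zero_smul, add_zero, hv, add_sub_cancel] at this
  simp only [one_mul, one_pow, zero_mul, ne_eq, OfNat.ofNat_ne_zero, not_false_eq_true, zero_pow,
    sub_zero] at this
  linarith

/-- An `L`-smooth objective `f` with gradient `G` and lower bound `c`, as used in descent
arguments. -/
structure IsSmoothObjective (f : E → ℝ) (G : E → E) (c L : ℝ) : Prop where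
  pos : 0 < L
  le : ∀ x, c ≤ f x
  descent : ∀ x y, f y ≤ f x + ⟪G x, y - x⟫ + L / 2 * ‖y - x‖ ^ 2
  lipschitz : ∀ x y, ‖G x - G y‖ ≤ L * ‖x - y‖

variable {f : E → ℝ} {G : E → E} {c L : ℝ}

/-- A gradient step of length `1/L` cannot go below the lower bound `c`. -/
theorem IsSmoothObjective.sq_norm_gradient_le (h : IsSmoothObjective f G c L) (x : E) :
    ‖G x‖ ^ 2 ≤ 2 * L * (f x - c) := by
  have hL := h.pos
  have h1 := (h.le _).trans (h.descent x (x - L⁻¹ • G x))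
  rw [sub_sub_cancel_left, norm_neg, inner_neg_right, inner_smul_right, norm_smul,
    real_inner_self_eq_norm_sq, mul_pow, Real.norm_eq_abs, sq_abs] at h1
  have h2 : L / 2 * (L⁻¹ ^ 2 * ‖G x‖ ^ 2) = L⁻¹ * ‖G x‖ ^ 2 / 2 := by field_simp
  have h3 : L⁻¹ * ‖G x‖ ^ 2 ≤ 2 * (f x - c) := by linarith
  rw [inv_mul_le_iff₀ hL] at h3
  linarith

/-- This transfers the gap from the auxiliary point `z` to the mean iterate; with `z = 0` it also
yields integrability. -/
theorem IsSmoothObjective.gap_sub_le (h : IsSmoothObjective f G c L) (z v : E) :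
    f (z + v) - c ≤ 2 * (f z - c) + L * ‖v‖ ^ 2 := by
  have hL := h.pos
  have h1 := h.descent z (z + v)
  rw [add_sub_cancel_left] at h1
  have h2 : ⟪G z, v⟫ ≤ (‖G z‖ ^ 2 / L + L * ‖v‖ ^ 2) / 2 := by
    have h3 : 0 ≤ (‖G z‖ - L * ‖v‖) ^ 2 / L := by positivity
    have h4 : (‖G z‖ - L * ‖v‖) ^ 2 / L = ‖G z‖ ^ 2 / L + L * ‖v‖ ^ 2 - 2 * (‖G z‖ * ‖v‖) := by
      field_simp
      ring
    linarith [real_inner_le_norm (G z) v]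
  have h5 : ‖G z‖ ^ 2 / L ≤ 2 * (f z - c) := by
    rw [div_le_iff₀ hL]
    linarith [h.sq_norm_gradient_le z]
  linarith

/-- The direction along which the noise enters the mean part of the energy to first order; `w` is
the weight of the momentum. -/
noncomputable def meanNoiseDir (G : E → E) (α β L w : ℝ) (x m g : E) : E :=
  -(α • G (x - (α * β / (1 - β)) • m)) + (α ^ 2 * L) • g
    + (2 * w * (1 - β)) • (β • m + (1 - β) • g)

/-- The surplus weight `e` will pay for the motion of the mean in the mode energy. Averaging the
momentum frees a share `1 - β` of its weight: one fifth covers the distance from `z` to `x`, three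
fifths cover `e`, and one fifth covers the rate `α μ`. -/
theorem IsSmoothObjective.mean_step_le (h : IsSmoothObjective f G c L) {α β μ e H : ℝ}
    (hPL : ∀ x, 2 * μ * (f x - c) ≤ ‖G x‖ ^ 2) (hα : 0 < α) (hβ₀ : 0 ≤ β) (hβ₁ : β < 1)
    (hαL : α * L ≤ (1 - β) / 5) (hαL' : α * L ≤ 1 / 10) (hαμ : α * μ ≤ (1 - β) / 5)
    (he₀ : 0 ≤ e) (he₁ : e ≤ 3 / 5 * (α ^ 2 * L)) (x m g δ : E)
    (hg : ‖G x - g‖ ^ 2 ≤ L ^ 2 * H) :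
    f (x - α • (β • m + (1 - β) • (g + δ))
          - (α * β / (1 - β)) • (β • m + (1 - β) • (g + δ))) - c
        + (α ^ 2 * L / (1 - β) ^ 2 + e) * ‖β • m + (1 - β) • (g + δ)‖ ^ 2
      ≤ (1 - α * μ) * (f (x - (α * β / (1 - β)) • m) - c + α ^ 2 * L / (1 - β) ^ 2 * ‖m‖ ^ 2)
        + α * L ^ 2 * H
        + ⟪meanNoiseDir G α β L (α ^ 2 * L / (1 - β) ^ 2 + e) x m g, δ⟫
        + 21 / 10 * (α ^ 2 * L) * ‖δ‖ ^ 2 := by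
  have hL := h.pos
  obtain ⟨q, hq⟩ : ∃ q, q = 1 - β := ⟨_, rfl⟩
  have hq0 : 0 < q := by linarith
  have hq1 : q ≤ 1 := by linarith
  obtain ⟨z, hz⟩ : ∃ z, z = x - (α * β / q) • m := ⟨_, rfl⟩
  obtain ⟨a, ha⟩ : ∃ a, a = α ^ 2 * L / q ^ 2 := ⟨_, rfl⟩
  have haq : a * q ^ 2 = α ^ 2 * L := by rw [ha]; field_simp
  have ha0 : 0 < a := by rw [ha]; positivity
  -- The momentum cancels: the auxiliary point moves by exactly `-α (g + δ)`.
  have hz' : x - α • (β • m + q • (g + δ)) - (α * β / q) • (β • m + q • (g + δ))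
      = z - α • (g + δ) := by
    have h1 : α * β / q * β = α * β / q - α * β := by rw [show β = 1 - q by linarith]; field_simp
    have h2 : α * β / q * q = α * β := by field_simp
    rw [hz, smul_add (α * β / q), smul_smul, smul_smul, h1, h2, hq]
    module
  rw [← hq, hz', ← hz, ← ha, meanNoiseDir, ← hq, ← hz]
  -- descent at `z`
  have d1 := h.descent z (z - α • (g + δ))
  rw [sub_sub_cancel_left, norm_neg, inner_neg_right, inner_smul_right, norm_smul, mul_pow,
    Real.norm_eq_abs, sq_abs, norm_add_sq_real, inner_add_right] at d1
  have d2 : ‖G z - g‖ ^ 2 ≤ 2 * (L ^ 2 * (α * β / q) ^ 2 * ‖m‖ ^ 2) + 2 * (L ^ 2 * H) := by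
    have h1 := sq_norm_add_le_young one_pos (G z - G x) (G x - g)
    rw [sub_add_sub_cancel] at h1
    have h2 : ‖G z - G x‖ ^ 2 ≤ (L * ‖z - x‖) ^ 2 := by gcongr; exact h.lipschitz z x
    rw [hz, sub_sub_cancel_left, norm_neg, norm_smul, ← hz, mul_pow, mul_pow, Real.norm_eq_abs,
      sq_abs] at h2
    linarith
  rw [norm_sub_sq_real] at d2
  have d3 : ‖β • m + q • (g + δ)‖ ^ 2 ≤ β * ‖m‖ ^ 2 + q * ‖g‖ ^ 2
      + 2 * q * ⟪β • m + q • g, δ⟫ + q ^ 2 * ‖δ‖ ^ 2 := by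
    have h1 := sq_norm_convex_comb_le hβ₀ hβ₁.le m g
    rw [← hq] at h1
    rw [show β • m + q • (g + δ) = (β • m + q • g) + q • δ by rw [smul_add]; abel,
      norm_add_sq_real _ (q • δ), inner_smul_right, norm_smul, mul_pow ‖q‖, Real.norm_eq_abs,
      sq_abs]
    linarith
  have d4 := hPL z
  have d5 := mul_le_mul_of_nonneg_left d3 (add_nonneg ha0.le he₀)
  rw [inner_add_left, inner_add_left, inner_neg_left, inner_smul_left, inner_smul_left,
    inner_smul_left]
  simp only [conj_trivial]
  -- the budget for `‖m‖²`
  have b1 : α * (L ^ 2 * (α * β / q) ^ 2) + (a + e) * β ≤ (1 - α * μ) * a := by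
    have h1 : α * (L ^ 2 * (α * β / q) ^ 2) = a * (α * L) * β ^ 2 := by rw [ha]; field_simp
    have h2 : a * (α * L) * β ^ 2 ≤ a * (q / 5) * 1 := by
      gcongr
      · linarith
      · exact pow_le_one₀ hβ₀ hβ₁.le
    have h3 : e * β ≤ 3 / 5 * (a * q ^ 2) * 1 := by
      gcongr
      linarith
    have h4 : a * q ^ 2 ≤ a * q := by gcongr; exact pow_le_of_le_one hq0.le hq1 two_ne_zero
    have h5 : α * μ * a ≤ q / 5 * a := by gcongr; linarith
    have h6 : (a + e) * β = a - a * q + e * β := by rw [hq]; ring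
    linarith
  -- the budget for `‖g‖²`
  have b2 : α ^ 2 * L / 2 + (a + e) * q ≤ α / 2 := by
    have h1 : a * q ≤ α / 5 := by
      have : a * q = α * (α * L) / q := by rw [ha]; field_simp
      rw [this, div_le_iff₀ hq0]
      have := mul_le_mul_of_nonneg_left hαL hα.le
      rw [← hq] at this
      linarith
    have h2 : e * q ≤ 3 / 5 * (α ^ 2 * L) * 1 := by gcongr
    have h3 : α * (α * L) ≤ α * (1 / 10) := by gcongr
    linarith
  -- Descent, momentum weight and surplus contribute `1/2 + 1 + 3/5 = 21/10`.
  have b3 : α ^ 2 * L / 2 + (a + e) * q ^ 2 ≤ 21 / 10 * (α ^ 2 * L) := by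
    have h2 : e * q ^ 2 ≤ 3 / 5 * (α ^ 2 * L) * 1 := by
      gcongr
      exact pow_le_one₀ hq0.le hq1
    linarith
  have c1 := mul_le_mul_of_nonneg_right b1 (sq_nonneg ‖m‖)
  have c2 := mul_le_mul_of_nonneg_right b2 (sq_nonneg ‖g‖)
  have c3 := mul_le_mul_of_nonneg_right b3 (sq_nonneg ‖δ‖)
  have c4 := mul_le_mul_of_nonneg_left d2 (by positivity : 0 ≤ α / 2)
  have c5 := mul_le_mul_of_nonneg_left d4 (by positivity : 0 ≤ α / 2)
  linarith

end Smooth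
-- Spectral decomposition of the disagreement
section Modes

variable {n d : ℕ}

local notation "⟪" x ", " y "⟫" => inner ℝ x y

theorem sum_sq_norm_smul_orthonormalBasis
    (v : OrthonormalBasis (Fin n) ℝ (EuclideanSpace ℝ (Fin n))) (X : Fin n → Vec d) :
    ∑ k, ‖∑ i, v k i • X i‖ ^ 2 = ∑ i, ‖X i‖ ^ 2 := by
  simp only [EuclideanSpace.norm_sq_eq, Real.norm_eq_abs, sq_abs]
  rw [Finset.sum_comm]
  conv_rhs => rw [Finset.sum_comm]
  refine Finset.sum_congr rfl fun a _ => ?_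
  have h := v.sum_sq_norm_inner_right (WithLp.toLp 2 fun i => X i a)
  simp only [EuclideanSpace.norm_sq_eq, Real.norm_eq_abs, sq_abs] at h
  rw [← h]
  refine Finset.sum_congr rfl fun k _ => ?_
  congr 1
  simp [PiLp.inner_apply, mul_comm]

/-- The eigenvalues `b` of the consensus modes of a communication matrix with mixing rate `l`, and
the coefficients `u` of these modes. -/
structure IsModeDecomposition (W : Matrix (Fin n) (Fin n) ℝ) (l : ℝ) (b : Fin n → ℝ)
    (u : Fin n → Fin n → ℝ) : Prop where
  nonneg : ∀ k, 0 ≤ b k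
  le : ∀ k, b k ≤ l
  sum_mul : ∀ k j, ∑ i, u k i * W i j = b k * u k j
  sum_eq_zero : ∀ k, ∑ i, u k i = 0
  parseval : ∀ {d : ℕ} (X : Fin n → Vec d), ∑ k, ‖∑ i, u k i • X i‖ ^ 2 = ∑ i, ‖X i - avg X‖ ^ 2

/-- The modes are centered eigenvectors of the symmetric matrix `W - (1/n) 1 1ᵀ`. Its columns sum to
zero, so an eigenvector with nonzero eigenvalue is already centered and is an eigenvector of `W`
with the same, hence positive, eigenvalue. The other eigenvectors lie in the kernel, where centering
keeps the eigenvalue relation. -/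
theorem exists_isModeDecomposition (hn : 0 < n) {W : Matrix (Fin n) (Fin n) ℝ}
    (hW : IsCommunicationMatrix W) :
    ∃ b u, IsModeDecomposition W (mixingRate W) b u := by
  have hn' : (n : ℝ) ≠ 0 := by positivity
  set B := W - avgMatrix n with hB
  have hBij : ∀ i j, B i j = W i j - (n : ℝ)⁻¹ := fun i j => rfl
  have hBs : ∀ i j, B i j = B j i := fun i j => by
    rw [hBij, hBij, hW.symm.apply]
  have hBh : B.IsHermitian := Matrix.IsHermitian.ext fun i j => by simp [hBs i j]
  have hcol : ∀ j, ∑ i, B i j = 0 := fun j => by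
    simp [hBij, hW.col_sum, hn']
  set v := hBh.eigenvectorBasis with hv
  set b := hBh.eigenvalues with hb
  have heig : ∀ k i, ∑ j, B i j * v k j = b k * v k i := fun k i => by
    have := congrFun (hBh.mulVec_eigenvectorBasis k) i
    simpa [Matrix.mulVec, dotProduct] using this
  have hbsum : ∀ k, b k * ∑ i, v k i = 0 := fun k => by
    rw [Finset.mul_sum, ← Finset.sum_congr rfl fun i _ => heig k i, Finset.sum_comm]
    simp [← Finset.sum_mul, hcol]
  have hvk : ∀ k, v k ≠ 0 := fun k => by
    have := v.orthonormal.1 k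
    intro h
    simp [h] at this
  refine ⟨b, fun k i => v k i - (n : ℝ)⁻¹ * ∑ j, v k j, ?_, ?_, ?_, ?_, ?_⟩
  · intro k
    rcases eq_or_ne (b k) 0 with h0 | h0
    · exact h0.ge
    refine (hW.eigenvalue_pos (b k) ?_).le
    have hs : ∑ i, v k i = 0 := (mul_eq_zero.1 (hbsum k)).resolve_left h0
    refine Module.End.hasEigenvalue_of_hasEigenvector (x := (v k).ofLp) ⟨?_, ?_⟩
    · rw [Module.End.mem_eigenspace_iff]
      ext i
      have := heig k i
      simp only [hBij, sub_mul, Finset.sum_sub_distrib, ← Finset.mul_sum, hs, mul_zero,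
        sub_zero] at this
      simpa [Matrix.toLin'_apply, Matrix.mulVec, dotProduct] using this
    · intro h
      exact hvk k (by ext i; exact congrFun h i)
  · intro k
    have h1 : Matrix.toEuclideanCLM (n := Fin n) (𝕜 := ℝ) B (v k) = b k • v k := by
      ext i
      rw [Matrix.ofLp_toEuclideanCLM]
      exact (heig k i)
    have h2 := (Matrix.toEuclideanCLM (n := Fin n) (𝕜 := ℝ) B).le_opNorm (v k)
    rw [h1, norm_smul, v.orthonormal.1 k, mul_one, mul_one] at h2
    exact (le_abs_self _).trans h2
  · intro k j
    have h1 := heig k j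
    simp only [hBs j] at h1
    simp only [hBij, sub_mul, Finset.sum_sub_distrib] at h1
    simp only [sub_mul, Finset.sum_sub_distrib, ← Finset.mul_sum, hW.col_sum]
    have h3 := hbsum k
    have h4 : ∑ i, W i j * v k i = ∑ i, v k i * W i j :=
      Finset.sum_congr rfl fun i _ => mul_comm _ _
    rw [← Finset.mul_sum, h4] at h1
    linear_combination h1 + (n : ℝ)⁻¹ * h3
  · intro k
    simp [hn']
  · intro d X
    rw [← sum_sq_norm_smul_orthonormalBasis v fun i => X i - avg X]
    refine Finset.sum_congr rfl fun k _ => ?_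
    congr 2
    simp only [smul_sub, sub_smul, Finset.sum_sub_distrib]
    rw [← Finset.smul_sum, ← Finset.sum_smul, avg, smul_smul, mul_comm]

variable {W : Matrix (Fin n) (Fin n) ℝ} {l : ℝ} {b : Fin n → ℝ} {u : Fin n → Fin n → ℝ}

/-- The component of `X` along the mode with coefficients `c`. -/
def mode (c : Fin n → ℝ) (X : Fin n → Vec d) : Vec d := ∑ i, c i • X i

theorem mode_add (c : Fin n → ℝ) (X Y : Fin n → Vec d) :
    mode c (fun i => X i + Y i) = mode c X + mode c Y := by
  simp [mode, Finset.sum_add_distrib]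

theorem mode_sub (c : Fin n → ℝ) (X Y : Fin n → Vec d) :
    mode c (fun i => X i - Y i) = mode c X - mode c Y := by
  simp [mode, smul_sub, Finset.sum_sub_distrib]

theorem mode_smul (c : Fin n → ℝ) (r : ℝ) (X : Fin n → Vec d) :
    mode c (fun i => r • X i) = r • mode c X := by
  simp [mode, Finset.smul_sum, smul_comm r]

theorem IsModeDecomposition.mode_const (h : IsModeDecomposition W l b u) (k : Fin n) (x : Vec d) :
    mode (u k) (fun _ => x) = 0 := by
  rw [mode, ← Finset.sum_smul, h.sum_eq_zero, zero_smul]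

theorem IsModeDecomposition.mode_mul (h : IsModeDecomposition W l b u) (k : Fin n)
    (X : Fin n → Vec d) :
    mode (u k) (fun i => ∑ j, W i j • X j) = b k • mode (u k) X := by
  simp only [mode, Finset.smul_sum, smul_smul]
  rw [Finset.sum_comm]
  simp only [← Finset.sum_smul, h.sum_mul]

theorem sum_sq_norm_sub_avg_le (X : Fin n → Vec d) :
    ∑ i, ‖X i - avg X‖ ^ 2 ≤ ∑ i, ‖X i‖ ^ 2 := by
  rcases Nat.eq_zero_or_pos n with rfl | hn
  · simp
  have hn' : (n : ℝ) ≠ 0 := by positivity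
  have h1 : ∑ i, X i = (n : ℝ) • avg X := by rw [avg, smul_smul, mul_inv_cancel₀ hn', one_smul]
  simp only [norm_sub_sq_real, Finset.sum_add_distrib, Finset.sum_sub_distrib, ← Finset.mul_sum,
    ← sum_inner]
  rw [h1, inner_smul_left, real_inner_self_eq_norm_sq]
  simp only [conj_trivial, Finset.sum_const, Finset.card_univ, Fintype.card_fin, nsmul_eq_mul]
  have : 0 ≤ (n : ℝ) * ‖avg X‖ ^ 2 := by positivity
  linarith

theorem IsModeDecomposition.sum_sq_norm_mode (h : IsModeDecomposition W l b u)
    (X : Fin n → Vec d) : ∑ k, ‖mode (u k) X‖ ^ 2 = ∑ i, ‖X i - avg X‖ ^ 2 := h.parseval X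

theorem IsModeDecomposition.sum_sq_norm_mode_le (h : IsModeDecomposition W l b u)
    (X : Fin n → Vec d) : ∑ k, ‖mode (u k) X‖ ^ 2 ≤ ∑ i, ‖X i‖ ^ 2 :=
  (h.sum_sq_norm_mode X).trans_le (sum_sq_norm_sub_avg_le X)

theorem sq_norm_avg_le (X : Fin n → Vec d) : ‖avg X‖ ^ 2 ≤ (n : ℝ)⁻¹ * ∑ i, ‖X i‖ ^ 2 := by
  rcases Nat.eq_zero_or_pos n with rfl | hn
  · simp [avg]
  have hn' : (0 : ℝ) < n := by positivity
  have h1 : ‖∑ i, X i‖ ^ 2 ≤ (∑ i, ‖X i‖) ^ 2 := by gcongr; exact norm_sum_le _ _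
  have h2 : (∑ i, ‖X i‖) ^ 2 ≤ n * ∑ i, ‖X i‖ ^ 2 := by
    simpa using sq_sum_le_card_mul_sum_sq (s := Finset.univ) (f := fun i => ‖X i‖)
  rw [avg, norm_smul, mul_pow, Real.norm_eq_abs, sq_abs]
  calc (n : ℝ)⁻¹ ^ 2 * ‖∑ i, X i‖ ^ 2 ≤ (n : ℝ)⁻¹ ^ 2 * (n * ∑ i, ‖X i‖ ^ 2) := by
        gcongr; exact h1.trans h2
    _ = _ := by field_simp

theorem avg_add (X Y : Fin n → Vec d) : avg (fun i => X i + Y i) = avg X + avg Y := by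
  simp [avg, Finset.sum_add_distrib]

theorem avg_sub (X Y : Fin n → Vec d) : avg (fun i => X i - Y i) = avg X - avg Y := by
  simp [avg, smul_sub, Finset.sum_sub_distrib]

theorem avg_smul (r : ℝ) (X : Fin n → Vec d) : avg (fun i => r • X i) = r • avg X := by
  simp [avg, ← Finset.smul_sum, smul_comm r]

theorem avg_const (hn : 0 < n) (x : Vec d) : avg (fun _ : Fin n => x) = x := by
  have hn' : (n : ℝ) ≠ 0 := by positivity
  simp [avg, ← Nat.cast_smul_eq_nsmul ℝ, smul_smul, hn']

theorem avg_mul (hW : IsCommunicationMatrix W) (X : Fin n → Vec d) :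
    avg (fun i => ∑ j, W i j • X j) = avg X := by
  unfold avg
  rw [Finset.sum_comm]
  simp only [← Finset.sum_smul, hW.col_sum, one_smul]

end Modes
-- One-step contraction of the Lyapunov function
section Lyapunov

variable {n d : ℕ}

local notation "⟪" x ", " y "⟫" => inner ℝ x y

/-- The weight of the energy of the consensus modes after a step of the algorithm. -/
noncomputable def modeWeight (l α L : ℝ) : ℝ := 80 / 3 * α * L ^ 2 * l ^ 2 / ((1 + l) * (1 - l))

theorem modeWeight_nonneg {l α L : ℝ} (hl₀ : 0 ≤ l) (hl₁ : l < 1) (hα : 0 ≤ α) :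
    0 ≤ modeWeight l α L := by
  have : 0 < 1 - l := sub_pos.2 hl₁
  unfold modeWeight
  positivity

/-- The Lyapunov function of the algorithm, as a function of its state `S` and of the pairs `r` of
the consensus modes. -/
noncomputable def lyapunov (b : Fin n → ℝ) (u : Fin n → Fin n → ℝ) (l α β L : ℝ)
    (f : Vec d → ℝ) (c : ℝ) (G : Fin n → Vec d → Vec d) (S : State n d)
    (r : Fin n → Vec d × Vec d) : ℝ :=
  (f (avg S.x - (α * β / (1 - β)) • avg S.m) - c + α ^ 2 * L / (1 - β) ^ 2 * ‖avg S.m‖ ^ 2)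
    + 2 * α * L ^ 2 / (1 - β) * ((n : ℝ)⁻¹ * ∑ k, ‖mode (u k) S.x‖ ^ 2)
    + (modeWeight l α L - 4 * α * L ^ 2 * l ^ 2 / (1 + l)) * ((n : ℝ)⁻¹ *
        ∑ k, modeEnergy (b k) (r k).1 ((r k).2 + α • mode (u k) (fun i => G i (avg S.x))))

/-- The contribution of the noise `δ` to the Lyapunov function to first order. -/
noncomputable def noiseTerm (b : Fin n → ℝ) (u : Fin n → Fin n → ℝ) (l α β L : ℝ)
    (G : Fin n → Vec d → Vec d) (S : State n d) (r : Fin n → Vec d × Vec d)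
    (δ : Fin n → Vec d) : ℝ :=
  ⟪meanNoiseDir (fun x => avg (fun i => G i x)) α β L
      (α ^ 2 * L / (1 - β) ^ 2 + modeWeight l α L * (9 / (1 - l) ^ 2 * (α ^ 4 * L ^ 2)))
      (avg S.x) (avg S.m) (avg fun i => G i (S.x i)), avg δ⟫
    + modeWeight l α L * ((n : ℝ)⁻¹ * ∑ k, ⟪modeNoiseDir l α (b k) (r k).1
        ((r k).2 + α • mode (u k) (fun i => G i (avg S.x)))
        (mode (u k) (fun i => G i (S.x i) - G i (avg S.x))), mode (u k) δ⟫)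

/-- The gradients at the mean are carried by the shift of `s`. What remains is the deviation `G i (x
i) - G i (avg x)`, controlled by the consensus error, and the drift of the shift, controlled by the
motion of the mean. -/
theorem sum_modeEnergy_step_le {W : Matrix (Fin n) (Fin n) ℝ} {b : Fin n → ℝ}
    {u : Fin n → Fin n → ℝ} {l α L : ℝ} {G : Fin n → Vec d → Vec d}
    (hl₁ : l < 1) (hM : IsModeDecomposition W l b u)
    (hG : ∀ i x y, ‖G i x - G i y‖ ≤ L * ‖x - y‖)
    (x : Fin n → Vec d) (x' : Vec d) (δ : Fin n → Vec d) (r : Fin n → Vec d × Vec d) :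
    ∑ k, modeEnergy (b k)
        (b k • (r k).1 - α • mode (u k) (fun i => G i (x i) + δ i) - (r k).2)
        ((r k).2 + (1 - b k) • (b k • (r k).1 - α • mode (u k) (fun i => G i (x i) + δ i) - (r k).2)
          + α • mode (u k) (fun i => G i x'))
      ≤ (1 - (1 - l) / 4) * ∑ k, modeEnergy (b k) (r k).1
            ((r k).2 + α • mode (u k) (fun i => G i (avg x)))
        + 16 / (1 - l) * α ^ 2 * (L ^ 2 * ∑ k, ‖mode (u k) x‖ ^ 2)
        + ∑ k, ⟪modeNoiseDir l α (b k) (r k).1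
            ((r k).2 + α • mode (u k) (fun i => G i (avg x)))
            (mode (u k) (fun i => G i (x i) - G i (avg x))), mode (u k) δ⟫
        + 2 * α ^ 2 * ∑ i, ‖δ i‖ ^ 2
        + 9 / (1 - l) ^ 2 * (α ^ 2 * (n * (L ^ 2 * ‖x' - avg x‖ ^ 2))) := by
  have hX : 0 < 1 - l := sub_pos.2 hl₁
  have hG2 : ∀ i y z, ‖G i y - G i z‖ ^ 2 ≤ L ^ 2 * ‖y - z‖ ^ 2 := fun i y z => by
    rw [← mul_pow]
    gcongr
    exact hG i y z
  have h1 : ∑ k, ‖mode (u k) (fun i => G i (x i) - G i (avg x))‖ ^ 2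
      ≤ L ^ 2 * ∑ k, ‖mode (u k) x‖ ^ 2 := by
    refine (hM.sum_sq_norm_mode_le _).trans ?_
    rw [hM.sum_sq_norm_mode, Finset.mul_sum]
    exact Finset.sum_le_sum fun i _ => hG2 i _ _
  have h2 : ∑ k, ‖α • mode (u k) (fun i => G i x' - G i (avg x))‖ ^ 2
      ≤ α ^ 2 * (n * (L ^ 2 * ‖x' - avg x‖ ^ 2)) := by
    simp only [norm_smul, mul_pow, Real.norm_eq_abs, sq_abs, ← Finset.mul_sum]
    gcongr
    refine (hM.sum_sq_norm_mode_le _).trans ?_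
    refine (Finset.sum_le_sum fun i _ => hG2 i x' (avg x)).trans ?_
    simp
  have h3 := hM.sum_sq_norm_mode_le δ
  have h4 := Finset.sum_le_sum fun k (_ : k ∈ Finset.univ) =>
    modeEnergy_step_le (α := α) (hM.nonneg k) (hM.le k) hl₁ (r k).1
      ((r k).2 + α • mode (u k) (fun i => G i (avg x)))
      (mode (u k) (fun i => G i (x i) - G i (avg x))) (mode (u k) δ)
      (α • mode (u k) (fun i => G i x' - G i (avg x)))
  simp only [Finset.sum_add_distrib, ← Finset.mul_sum] at h4
  have h5 : ∀ k, modeEnergy (b k)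
        (b k • (r k).1 - α • mode (u k) (fun i => G i (x i) + δ i) - (r k).2)
        ((r k).2 + (1 - b k) • (b k • (r k).1 - α • mode (u k) (fun i => G i (x i) + δ i) - (r k).2)
          + α • mode (u k) (fun i => G i x'))
      = modeEnergy (b k)
        (b k • (r k).1 - α • (mode (u k) (fun i => G i (x i) - G i (avg x)) + mode (u k) δ)
          - ((r k).2 + α • mode (u k) (fun i => G i (avg x))))
        ((r k).2 + α • mode (u k) (fun i => G i (avg x)) + (1 - b k) •
          (b k • (r k).1 - α • (mode (u k) (fun i => G i (x i) - G i (avg x)) + mode (u k) δ)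
          - ((r k).2 + α • mode (u k) (fun i => G i (avg x))))
          + α • mode (u k) (fun i => G i x' - G i (avg x))) := fun k => by
    rw [mode_add, mode_sub, mode_sub]
    congr 1 <;> module
  rw [Finset.sum_congr rfl fun k _ => h5 k]
  refine h4.trans ?_
  gcongr

variable {W : Matrix (Fin n) (Fin n) ℝ} {b : Fin n → ℝ} {u : Fin n → Fin n → ℝ}
  {l α β L μ c : ℝ} {f : Vec d → ℝ} {G : Fin n → Vec d → Vec d}

theorem sum_sq_norm_mode_smoothing_le (hM : IsModeDecomposition W l b u) (hl₁ : l < 1)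
    (hβ₀ : 0 ≤ β) (hβ₁ : β < 1) (y φ s : Fin n → Vec d) :
    ∑ k, ‖β • y k + (1 - β) • b k • φ k‖ ^ 2
      ≤ β * ∑ k, ‖y k‖ ^ 2
        + (1 - β) * (2 * l ^ 2 / (1 + l) * ∑ k, modeEnergy (b k) (φ k) (s k)) := by
  simp only [Finset.mul_sum, ← Finset.sum_add_distrib]
  refine Finset.sum_le_sum fun k _ => (sq_norm_convex_comb_le hβ₀ hβ₁.le _ _).trans ?_
  have hb0 := hM.nonneg k
  have hbl := hM.le k
  have hb1 : 0 < 1 - b k := by linarith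
  have hq : 0 ≤ 1 - β := by linarith
  gcongr
  rw [norm_smul, mul_pow, Real.norm_eq_abs, sq_abs]
  -- The function `b² / (1 + b)` is increasing, and `b k ≤ l`.
  have h1 : b k ^ 2 ≤ 2 * l ^ 2 / (1 + l) * ((1 + b k) / 2) := by
    have hl0 : 0 ≤ l := hb0.trans hbl
    rw [div_mul_div_comm, le_div_iff₀ (by positivity)]
    have h2 : b k ^ 2 ≤ l ^ 2 := by gcongr
    have h3 : 0 ≤ b k * l * (l - b k) := mul_nonneg (mul_nonneg hb0 hl0) (sub_nonneg.2 hbl)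
    linarith
  have hl0 : 0 ≤ l := hb0.trans hbl
  have h2 : (1 + b k) / 2 * ‖φ k‖ ^ 2 ≤ modeEnergy (b k) (φ k) (s k) := by
    unfold modeEnergy
    have : 0 ≤ ‖s k‖ ^ 2 / (1 - b k) := by positivity
    linarith
  calc b k ^ 2 * ‖φ k‖ ^ 2 ≤ 2 * l ^ 2 / (1 + l) * ((1 + b k) / 2) * ‖φ k‖ ^ 2 := by gcongr
    _ = 2 * l ^ 2 / (1 + l) * ((1 + b k) / 2 * ‖φ k‖ ^ 2) := by ring
    _ ≤ _ := by gcongr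

theorem sqrt_facts (hl₀ : 0 ≤ l) (hl₁ : l < 1) : 0 ≤ √l ∧ √l < 1 ∧ l = √l ^ 2 :=
  ⟨Real.sqrt_nonneg l, by rwa [Real.sqrt_lt' one_pos, one_pow], (Real.sq_sqrt hl₀).symm⟩

theorem mul_le_one_sub_div_ten (hl₀ : 0 ≤ l) (hl₁ : l < 1) (h : α * L ≤ (1 - √l) / 10) :
    α * L ≤ (1 - l) / 10 := by
  obtain ⟨h0, h1, h2⟩ := sqrt_facts hl₀ hl₁
  nlinarith

/-- The left side is the surplus weight `e` of `IsSmoothObjective.mean_step_le`. -/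
theorem modeWeight_drift_le (hl₀ : 0 ≤ l) (hl₁ : l < 1) (hα : 0 < α) (hL : 0 < L)
    (h : α * L ≤ (1 - l) / 10) :
    modeWeight l α L * (9 / (1 - l) ^ 2 * (α ^ 4 * L ^ 2)) ≤ 3 / 5 * (α ^ 2 * L) := by
  have hX : 0 < 1 - l := sub_pos.2 hl₁
  have e : modeWeight l α L * (9 / (1 - l) ^ 2 * (α ^ 4 * L ^ 2))
      = 240 * (α ^ 2 * L) * (l ^ 2 / (1 + l)) * (α * L / (1 - l)) ^ 3 := by
    unfold modeWeight
    field_simp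
    ring
  have h1 : l ^ 2 / (1 + l) ≤ 1 := by
    rw [div_le_one (by linarith)]
    nlinarith
  have h2 : α * L / (1 - l) ≤ 1 / 10 := by
    rw [div_le_iff₀ hX]
    linarith
  rw [e]
  calc 240 * (α ^ 2 * L) * (l ^ 2 / (1 + l)) * (α * L / (1 - l)) ^ 3
      ≤ 240 * (α ^ 2 * L) * 1 * (1 / 10) ^ 3 := by gcongr
    _ ≤ _ := by
      have : 0 < α ^ 2 * L := by positivity
      linarith

/-- The subtracted weight is the fraction `3/20 (1 - l)` of `modeWeight`. Of the contraction margin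
`(1 - l)/4` this leaves `(1 - l)/10`, enough for `α μ`. -/
theorem modeWeight_contraction (hl₀ : 0 ≤ l) (hl₁ : l < 1) (hα : 0 < α)
    (h : α * μ ≤ (1 - l) / 10) (hμ : 0 ≤ α * μ) :
    modeWeight l α L * (1 - (1 - l) / 4)
      ≤ (1 - α * μ) * (modeWeight l α L - 4 * α * L ^ 2 * l ^ 2 / (1 + l)) := by
  have hX : 0 < 1 - l := sub_pos.2 hl₁
  have e : 4 * α * L ^ 2 * l ^ 2 / (1 + l) = modeWeight l α L * (3 / 20 * (1 - l)) := by
    unfold modeWeight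
    field_simp
    ring
  rw [e]
  have hK := modeWeight_nonneg (L := L) hl₀ hl₁ hα.le
  have h1 : 1 - (1 - l) / 4 ≤ (1 - α * μ) * (1 - 3 / 20 * (1 - l)) := by
    nlinarith [mul_nonneg hμ hX.le]
  calc _ ≤ modeWeight l α L * ((1 - α * μ) * (1 - 3 / 20 * (1 - l))) := by gcongr
    _ = _ := by ring

/-- Smoothing frees `2 α L²`. Mean descent takes `1`, the driving of the modes at most `3/5`, and
the rate `α μ` at most `2/5`, in units of `α L²`. -/
theorem consensusWeight_contraction (hl₀ : 0 ≤ l) (hl₁ : l < 1) (hα : 0 < α) (hL : 0 < L)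
    (hβ₁ : β < 1) (h : α * L ≤ (1 - √l) / 10) (hαμ : α * μ ≤ (1 - β) / 5) :
    2 * α * L ^ 2 / (1 - β) * β + α * L ^ 2 + modeWeight l α L * (16 / (1 - l) * α ^ 2 * L ^ 2)
      ≤ (1 - α * μ) * (2 * α * L ^ 2 / (1 - β)) := by
  obtain ⟨h0, h1, h2⟩ := sqrt_facts hl₀ hl₁
  set s := √l
  have hq : 0 < 1 - β := sub_pos.2 hβ₁
  have hX : 0 < 1 - l := sub_pos.2 hl₁
  have hs : 0 < 1 - s := sub_pos.2 h1
  have e : modeWeight l α L * (16 / (1 - l) * α ^ 2 * L ^ 2)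
      = 1280 / 3 * (l ^ 2 / ((1 + l) * (1 + s) ^ 2)) * (α * L / (1 - s)) ^ 2 * (α * L ^ 2) := by
    have hX2 : 1 - l = (1 - s) * (1 + s) := by rw [h2]; ring
    unfold modeWeight
    rw [hX2]
    field_simp
    ring
  have h3 : l ^ 2 / ((1 + l) * (1 + s) ^ 2) ≤ 1 / 8 := by
    rw [div_le_div_iff₀ (by positivity) (by norm_num)]
    have h4 : 2 * l ≤ 1 + l := by linarith
    have h5 : 4 * l ≤ (1 + s) ^ 2 := by nlinarith
    nlinarith [mul_le_mul h4 h5 (by positivity) (by positivity)]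
  have h6 : α * L / (1 - s) ≤ 1 / 10 := by
    rw [div_le_iff₀ hs]
    linarith
  have h7 : modeWeight l α L * (16 / (1 - l) * α ^ 2 * L ^ 2) ≤ 3 / 5 * (α * L ^ 2) := by
    rw [e]
    calc _ ≤ 1280 / 3 * (1 / 8) * (1 / 10) ^ 2 * (α * L ^ 2) := by gcongr
      _ ≤ _ := by
        have : 0 < α * L ^ 2 := by positivity
        linarith
  have h8 : 2 * α * L ^ 2 / (1 - β) * β = 2 * α * L ^ 2 / (1 - β) - 2 * (α * L ^ 2) := by
    field_simp
    ring
  have h9 : α * μ * (2 * α * L ^ 2 / (1 - β)) ≤ 2 / 5 * (α * L ^ 2) := by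
    calc _ ≤ (1 - β) / 5 * (2 * α * L ^ 2 / (1 - β)) := by gcongr
      _ = _ := by field_simp
  linarith

theorem lyapunov_step_le (hn : 0 < n) (hW : IsCommunicationMatrix W)
    (hM : IsModeDecomposition W l b u)
    (hf : IsSmoothObjective f (fun x => avg (fun i => G i x)) c L)
    (hG : ∀ i x y, ‖G i x - G i y‖ ≤ L * ‖x - y‖)
    (hPL : ∀ x, 2 * μ * (f x - c) ≤ ‖avg (fun i => G i x)‖ ^ 2)
    (hl₀ : 0 ≤ l) (hl₁ : l < 1) (hα : 0 < α) (hβ₀ : 0 ≤ β) (hβ₁ : β < 1) (hμ : 0 < μ)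
    (hμL : μ ≤ L) (hαl : α * L ≤ (1 - √l) / 10) (hαβ : α * L ≤ (1 - β) / 5)
    (S : State n d) (δ : Fin n → Vec d) (r r' : Fin n → Vec d × Vec d)
    (hr : ∀ k, r' k = (b k • (r k).1 - α • mode (u k) (fun i => G i (S.x i) + δ i) - (r k).2,
      (r k).2 + (1 - b k) •
        (b k • (r k).1 - α • mode (u k) (fun i => G i (S.x i) + δ i) - (r k).2)))
    (havg : avg S.ψ = avg S.x)
    (hx : ∀ k, mode (u k) (step W α β (fun i => G i (S.x i) + δ i) S).x
      = β • mode (u k) S.x + (1 - β) • b k • (r' k).1) :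
    lyapunov b u l α β L f c G (step W α β (fun i => G i (S.x i) + δ i) S) r'
      ≤ (1 - α * μ) * lyapunov b u l α β L f c G S r + noiseTerm b u l α β L G S r δ
        + 21 / 10 * (α ^ 2 * L) * ‖avg δ‖ ^ 2
        + modeWeight l α L * (2 * α ^ 2) * ((n : ℝ)⁻¹ * ∑ i, ‖δ i‖ ^ 2) := by
  have hn' : (0 : ℝ) < n := by positivity
  have hL := hf.pos
  have hq : 0 < 1 - β := sub_pos.2 hβ₁
  have hX : 0 < 1 - l := sub_pos.2 hl₁
  have hαX := mul_le_one_sub_div_ten hl₀ hl₁ hαl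
  have hαμL : α * μ ≤ α * L := by gcongr
  have hK := modeWeight_nonneg (L := L) hl₀ hl₁ hα.le
  set S' := step W α β (fun i => G i (S.x i) + δ i) S with hS'
  have hm' : avg S'.m = β • avg S.m + (1 - β) • (avg (fun i => G i (S.x i)) + avg δ) := by
    simp only [hS', step]
    rw [avg_add, avg_smul, avg_smul, avg_add]
  have hx' : avg S'.x = avg S.x - α • avg S'.m := by
    simp only [hS', step]
    rw [avg_mul hW, avg_sub, avg_add, avg_sub, avg_smul, havg]
    abel
  have hA : ∑ k, ‖mode (u k) S.x‖ ^ 2 = ∑ i, ‖S.x i - avg S.x‖ ^ 2 := hM.sum_sq_norm_mode _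
  have hg : ‖avg (fun i => G i (avg S.x)) - avg (fun i => G i (S.x i))‖ ^ 2
      ≤ L ^ 2 * ((n : ℝ)⁻¹ * ∑ k, ‖mode (u k) S.x‖ ^ 2) := by
    rw [← avg_sub, hA]
    refine (sq_norm_avg_le _).trans ?_
    rw [mul_left_comm]
    gcongr
    rw [Finset.mul_sum]
    refine Finset.sum_le_sum fun i _ => ?_
    rw [← mul_pow, norm_sub_rev (S.x i)]
    gcongr
    exact hG i _ _
  have m1 := hf.mean_step_le hPL hα hβ₀ hβ₁ hαβ (by linarith) (hαμL.trans hαβ)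
    (mul_nonneg hK (by positivity)) (modeWeight_drift_le hl₀ hl₁ hα hL hαX)
    (avg S.x) (avg S.m) _ (avg δ) hg
  rw [← hm', ← hx'] at m1
  have m2 := mul_le_mul_of_nonneg_left
    (sum_modeEnergy_step_le (α := α) hl₁ hM hG S.x (avg S'.x) δ r) (inv_nonneg.2 hn'.le)
  have hr1 : ∀ k, (r' k).1
      = b k • (r k).1 - α • mode (u k) (fun i => G i (S.x i) + δ i) - (r k).2 :=
    fun k => by rw [hr]
  have hr2 : ∀ k, (r' k).2 = (r k).2 + (1 - b k) • (r' k).1 := fun k => by rw [hr]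
  simp only [← hr1] at m2
  simp only [← hr2] at m2
  rw [show avg S'.x - avg S.x = -(α • avg S'.m) by rw [hx']; abel, norm_neg, norm_smul, mul_pow,
    Real.norm_eq_abs, sq_abs] at m2
  have m3 := mul_le_mul_of_nonneg_left (sum_sq_norm_mode_smoothing_le hM hl₁ hβ₀ hβ₁
    (fun k => mode (u k) S.x) (fun k => (r' k).1)
    (fun k => (r' k).2 + α • mode (u k) (fun i => G i (avg S'.x)))) (inv_nonneg.2 hn'.le)
  simp only [← hx] at m3
  unfold lyapunov noiseTerm
  set A := ∑ k, ‖mode (u k) S.x‖ ^ 2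
  set A' := ∑ k, ‖mode (u k) S'.x‖ ^ 2
  set Q := ∑ k, modeEnergy (b k) (r k).1 ((r k).2 + α • mode (u k) (fun i => G i (avg S.x)))
    with hQ
  set Q' := ∑ k, modeEnergy (b k) (r' k).1 ((r' k).2 + α • mode (u k) (fun i => G i (avg S'.x)))
  set N := ∑ k, ⟪modeNoiseDir l α (b k) (r k).1
            ((r k).2 + α • mode (u k) (fun i => G i (avg S.x)))
            (mode (u k) (fun i => G i (S.x i) - G i (avg S.x))), mode (u k) δ⟫
  set Δ := ∑ i, ‖δ i‖ ^ 2
  have hQ0 : 0 ≤ Q := Finset.sum_nonneg fun k _ =>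
    modeEnergy_nonneg (hM.nonneg k) ((hM.le k).trans_lt hl₁) _ _
  have hA0 : 0 ≤ A := by positivity
  have c1 := mul_le_mul_of_nonneg_right (modeWeight_contraction (L := L) hl₀ hl₁ hα
    (hαμL.trans hαX) (by positivity)) (mul_nonneg (inv_nonneg.2 hn'.le) hQ0)
  have c2 := mul_le_mul_of_nonneg_right (consensusWeight_contraction hl₀ hl₁ hα hL hβ₁ hαl
    (hαμL.trans hαβ)) (mul_nonneg (inv_nonneg.2 hn'.le) hA0)
  have c3 := mul_le_mul_of_nonneg_left m2 hK
  have c4 := mul_le_mul_of_nonneg_left m3 (by positivity : 0 ≤ 2 * α * L ^ 2 / (1 - β))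
  -- The new consensus error is bounded by the new energy `Q'`. Its cost is exactly the amount
  -- subtracted from `modeWeight` in `lyapunov`, so `Q'` is charged with full weight `modeWeight`.
  have e1 : 2 * α * L ^ 2 / (1 - β) * ((n : ℝ)⁻¹ * (β * A + (1 - β) * (2 * l ^ 2 / (1 + l) * Q')))
      = 2 * α * L ^ 2 / (1 - β) * β * ((n : ℝ)⁻¹ * A)
        + 4 * α * L ^ 2 * l ^ 2 / (1 + l) * ((n : ℝ)⁻¹ * Q') := by
    field_simp
    ring
  have e2 : (n : ℝ)⁻¹ * (9 / (1 - l) ^ 2 * (α ^ 2 * (n * (L ^ 2 * (α ^ 2 * ‖avg S'.m‖ ^ 2)))))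
      = 9 / (1 - l) ^ 2 * (α ^ 4 * L ^ 2) * ‖avg S'.m‖ ^ 2 := by
    field_simp
  rw [e1] at c4
  rw [mul_add (n : ℝ)⁻¹ _ (9 / (1 - l) ^ 2 * _), e2] at c3
  linarith

end Lyapunov
-- Conditional expectations and square-integrable adapted vectors
section Conditioning

set_option linter.unusedSectionVars false

variable {Ω E : Type*} [NormedAddCommGroup E] [InnerProductSpace ℝ E] [CompleteSpace E]
  {m₁ m₂ m : MeasurableSpace Ω} {P : Measure Ω}

theorem _root_.MeasureTheory.MemLp.integrable_inner_real {X Y : Ω → E} (hX : MemLp X 2 P)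
    (hY : MemLp Y 2 P) : Integrable (fun ω => inner ℝ (X ω) (Y ω)) P :=
  memLp_one_iff_integrable.1 (hX.of_bilin (fun x y => inner ℝ x y) 1 hY
    (hX.1.inner hY.1) (ae_of_all _ fun ω => by
      rw [← NNReal.coe_le_coe]
      simpa using norm_inner_le_norm (𝕜 := ℝ) (X ω) (Y ω)))

theorem integral_inner_eq_zero_of_condExp_eq_zero (hm : m₁ ≤ m) [IsProbabilityMeasure P]
    {V Y : Ω → E} (hV : StronglyMeasurable[m₁] V) (hV2 : MemLp V 2 P) (hY2 : MemLp Y 2 P)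
    (hY : P[Y | m₁] =ᵐ[P] 0) : ∫ ω, inner ℝ (V ω) (Y ω) ∂P = 0 := by
  have h := condExp_bilin_of_stronglyMeasurable_left (innerSL ℝ) hV
    (hV2.integrable_inner_real hY2) (hY2.integrable one_le_two)
  rw [← integral_condExp hm]
  refine (integral_congr_ae h).trans ?_
  refine integral_eq_zero_of_ae ?_
  filter_upwards [hY] with ω hω
  simp [hω]

theorem sup_eq_generateFrom_inter (m₁ m₂ : MeasurableSpace Ω) :
    m₁ ⊔ m₂ = MeasurableSpace.generateFrom
      {s | ∃ t u, MeasurableSet[m₁] t ∧ MeasurableSet[m₂] u ∧ t ∩ u = s} := by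
  apply le_antisymm
  · refine sup_le (fun t ht => ?_) (fun t ht => ?_)
    · exact MeasurableSpace.measurableSet_generateFrom ⟨t, Set.univ, ht, .univ, Set.inter_univ t⟩
    · exact MeasurableSpace.measurableSet_generateFrom ⟨Set.univ, t, .univ, ht, Set.univ_inter t⟩
  · refine MeasurableSpace.generateFrom_le ?_
    rintro s ⟨t, u, ht, hu, rfl⟩
    exact MeasurableSet.inter ((le_sup_left : m₁ ≤ m₁ ⊔ m₂) _ ht)
      ((le_sup_right : m₂ ≤ m₁ ⊔ m₂) _ hu)

/-- Adjoining information independent of `m₁`, which contains both `m₀` and `Y`, keeps the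
conditional mean zero. It suffices to test on intersections `t ∩ u`, which form a π-system
generating `m₀ ⊔ m₂`. -/
theorem condExp_sup_eq_zero {m₀ : MeasurableSpace Ω} (hm₀ : m₀ ≤ m) (hm₁ : m₁ ≤ m) (hm₂ : m₂ ≤ m)
    [IsProbabilityMeasure P] (h₀₁ : m₀ ≤ m₁) {Y : Ω → E} (hYm : StronglyMeasurable[m₁] Y)
    (hYi : Integrable Y P) (hY : P[Y | m₀] =ᵐ[P] 0) (hind : Indep m₁ m₂ P) :
    P[Y | m₀ ⊔ m₂] =ᵐ[P] 0 := by
  have key : ∀ s, MeasurableSet[m₀ ⊔ m₂] s → ∫ ω in s, Y ω ∂P = 0 := by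
    have huniv : ∫ ω, Y ω ∂P = 0 := by
      rw [← integral_condExp hm₀]
      exact integral_eq_zero_of_ae hY
    intro s hs
    induction s, hs using MeasurableSpace.induction_on_inter
      (sup_eq_generateFrom_inter m₀ m₂) with
    | h_inter =>
      rintro _ ⟨t, u, ht, hu, rfl⟩ _ ⟨t', u', ht', hu', rfl⟩ -
      exact ⟨t ∩ t', u ∩ u', ht.inter ht', hu.inter hu', Set.inter_inter_inter_comm t t' u u'⟩
    | empty => simp
    | basic s hs =>
      obtain ⟨t, u, ht, hu, rfl⟩ := hs
      -- Given `m₂`, the variable `1_t Y` has constant conditional mean `∫_t Y = 0`.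
      have h1 := condExp_indep_eq hm₁ hm₂ (hYm.indicator (h₀₁ _ ht)) hind
      have h2 : ∫ ω, t.indicator Y ω ∂P = 0 := by
        rw [integral_indicator (hm₀ _ ht), ← setIntegral_condExp hm₀ hYi ht]
        exact integral_eq_zero_of_ae (ae_restrict_of_ae hY)
      have h3 := setIntegral_condExp hm₂ (hYi.indicator (hm₀ _ ht)) hu
      rw [setIntegral_indicator (hm₀ _ ht), Set.inter_comm] at h3
      rw [← h3]
      refine integral_eq_zero_of_ae (ae_restrict_of_ae ?_)
      filter_upwards [h1] with ω hω
      rw [hω, h2]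
      rfl
    | compl s hs ih =>
      have := integral_add_compl (sup_le hm₀ hm₂ s hs) hYi
      rwa [ih, zero_add, huniv] at this
    | iUnion s hd hs ih =>
      rw [integral_iUnion (fun i => sup_le hm₀ hm₂ _ (hs i)) hd hYi.integrableOn]
      simp [ih]
  refine (ae_eq_condExp_of_forall_setIntegral_eq (sup_le hm₀ hm₂) hYi
    (fun s _ _ => integrableOn_zero) (fun s hs _ => ?_)
    stronglyMeasurable_zero.aestronglyMeasurable).symm
  simp [key s hs]

/-- A random vector that is `m`-measurable and square integrable. -/
structure IsSquareAdapted (m : MeasurableSpace Ω) {mΩ : MeasurableSpace Ω} (P : Measure Ω)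
    (X : Ω → E) : Prop where
  stronglyMeasurable : StronglyMeasurable[m] X
  memLp : MemLp X 2 P

namespace IsSquareAdapted

variable {X Y : Ω → E}

theorem mono (h : m₁ ≤ m₂) (hX : IsSquareAdapted m₁ P X) : IsSquareAdapted m₂ P X :=
  ⟨hX.1.mono h, hX.2⟩

theorem add (hX : IsSquareAdapted m₁ P X) (hY : IsSquareAdapted m₁ P Y) :
    IsSquareAdapted m₁ P (fun ω => X ω + Y ω) := ⟨hX.1.add hY.1, hX.2.add hY.2⟩

theorem sub (hX : IsSquareAdapted m₁ P X) (hY : IsSquareAdapted m₁ P Y) :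
    IsSquareAdapted m₁ P (fun ω => X ω - Y ω) := ⟨hX.1.sub hY.1, hX.2.sub hY.2⟩

theorem neg (hX : IsSquareAdapted m₁ P X) : IsSquareAdapted m₁ P (fun ω => -X ω) :=
  ⟨hX.1.neg, hX.2.neg⟩

theorem smul (c : ℝ) (hX : IsSquareAdapted m₁ P X) : IsSquareAdapted m₁ P (fun ω => c • X ω) :=
  ⟨hX.1.const_smul c, hX.2.const_smul c⟩

theorem const [IsFiniteMeasure P] (x : E) : IsSquareAdapted m₁ P (fun _ => x) :=
  ⟨stronglyMeasurable_const, memLp_const x⟩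

theorem sum {ι : Type*} (s : Finset ι) {X : ι → Ω → E} (hX : ∀ i, IsSquareAdapted m₁ P (X i)) :
    IsSquareAdapted m₁ P (fun ω => ∑ i ∈ s, X i ω) :=
  ⟨Finset.stronglyMeasurable_fun_sum s fun i _ => (hX i).1, memLp_finsetSum s fun i _ => (hX i).2⟩

theorem comp_lipschitz [IsFiniteMeasure P] {G : E → E} {L : ℝ}
    (hG : ∀ x y, ‖G x - G y‖ ≤ L * ‖x - y‖) (hX : IsSquareAdapted m₁ P X) :
    IsSquareAdapted m₁ P (fun ω => G (X ω)) := by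
  have hL : LipschitzWith L.toNNReal G := LipschitzWith.of_dist_le_mul fun x y => by
    rw [dist_eq_norm, dist_eq_norm]
    exact (hG x y).trans (by gcongr; exact Real.le_coe_toNNReal L)
  refine ⟨hL.continuous.comp_stronglyMeasurable hX.1, ?_⟩
  have h0 : LipschitzWith L.toNNReal (fun x => G x - G 0) := LipschitzWith.of_dist_le_mul
    fun x y => by simpa using hL.dist_le_mul x y
  have := (h0.comp_memLp (by simp) hX.2).add (memLp_const (G 0))
  simpa [Function.comp_def, Pi.add_def] using this

theorem avg {n d : ℕ} {X : Fin n → Ω → Vec d} (hX : ∀ i, IsSquareAdapted m₁ P (X i)) :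
    IsSquareAdapted m₁ P (fun ω => EDM.avg fun i => X i ω) :=
  (IsSquareAdapted.sum Finset.univ hX).smul _

theorem mode {n d : ℕ} (c : Fin n → ℝ) {X : Fin n → Ω → Vec d}
    (hX : ∀ i, IsSquareAdapted m₁ P (X i)) :
    IsSquareAdapted m₁ P (fun ω => EDM.mode c fun i => X i ω) :=
  IsSquareAdapted.sum Finset.univ fun i => (hX i).smul (c i)

theorem integrable_sq_norm (hX : IsSquareAdapted m₁ P X) : Integrable (fun ω => ‖X ω‖ ^ 2) P :=
  hX.2.integrable_norm_pow two_ne_zero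

end IsSquareAdapted

end Conditioning
-- Smoothness of the global objective
section Objective

variable {n d : ℕ}

theorem hasGradientAt_globalObj {f : Fin n → Vec d → ℝ} (hf : ∀ i, Differentiable ℝ (f i))
    (x : Vec d) : HasGradientAt (globalObj f) (avg fun i => gradient (f i) x) x := by
  rw [hasGradientAt_iff_hasFDerivAt]
  have h := (HasFDerivAt.fun_sum (u := Finset.univ) fun i _ =>
    ((hf i x).hasGradientAt).hasFDerivAt).const_mul (n : ℝ)⁻¹
  convert! h using 1
  simp [avg, map_sum]

theorem IsSmoothFamily.bddBelow_globalObj {f : Fin n → Vec d → ℝ} {L : ℝ}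
    (hf : IsSmoothFamily f L) : BddBelow (Set.range (globalObj f)) := by
  choose c hc using hf.bddBelow
  refine ⟨(n : ℝ)⁻¹ * ∑ i, c i, ?_⟩
  rintro _ ⟨x, rfl⟩
  unfold globalObj
  gcongr with i
  exact hc i ⟨x, rfl⟩

theorem norm_avg_le (X : Fin n → Vec d) : ‖avg X‖ ≤ (n : ℝ)⁻¹ * ∑ i, ‖X i‖ := by
  rw [avg, norm_smul, Real.norm_of_nonneg (by positivity)]
  gcongr
  exact norm_sum_le _ _

theorem IsSmoothFamily.isSmoothObjective {f : Fin n → Vec d → ℝ} {L : ℝ} (hn : 0 < n) (hL : 0 < L)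
    (hf : IsSmoothFamily f L) :
    IsSmoothObjective (globalObj f) (fun x => avg fun i => gradient (f i) x)
      (optValue (globalObj f)) L := by
  have hg := hasGradientAt_globalObj hf.differentiable
  have hlip : ∀ x y, ‖avg (fun i => gradient (f i) x) - avg (fun i => gradient (f i) y)‖
      ≤ L * ‖x - y‖ := fun x y => by
    rw [← avg_sub]
    refine (norm_avg_le _).trans ?_
    have hn' : (n : ℝ) ≠ 0 := by positivity
    calc _ ≤ (n : ℝ)⁻¹ * ∑ _i : Fin n, L * ‖x - y‖ := by
          gcongr with i
          exact hf.lipschitz i x y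
      _ = _ := by
        simp only [Finset.sum_const, Finset.card_univ, Fintype.card_fin, nsmul_eq_mul]
        field_simp
  refine ⟨hL, fun x => ciInf_le hf.bddBelow_globalObj x, fun x y => ?_, hlip⟩
  have := le_quadratic_of_lipschitz_gradient (L := L) (fun x => (hg x).differentiableAt)
    (fun x y => by rw [(hg x).gradient, (hg y).gradient]; exact hlip x y) x y
  rwa [(hg x).gradient] at this

end Objective

/-! ### The Lyapunov function along a run -/

section Run

variable {n d p : ℕ} {W : Matrix (Fin n) (Fin n) ℝ} {b : Fin n → ℝ} {u : Fin n → Fin n → ℝ}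
  {l α β L μ c : ℝ} {f : Vec d → ℝ} {G : Fin n → Vec d → Vec d}
  {F : Fin n → Vec d → Vec p → ℝ} {x₀ : Vec d} {z : Fin n → ℕ → Vec p}

/-- The stochastic gradients used along the run on the data `z`. -/
noncomputable def runGrad (W : Matrix (Fin n) (Fin n) ℝ) (α β : ℝ) (F : Fin n → Vec d → Vec p → ℝ)
    (x₀ : Vec d) (z : Fin n → ℕ → Vec p) (t : ℕ) (i : Fin n) : Vec d :=
  stochGrad F i ((run W α β F x₀ z t).x i) (z i t)

/-- The pairs of the consensus modes along the run on the data `z`. -/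
noncomputable def runModes (W : Matrix (Fin n) (Fin n) ℝ) (α β : ℝ)
    (F : Fin n → Vec d → Vec p → ℝ) (x₀ : Vec d) (z : Fin n → ℕ → Vec p) (b : Fin n → ℝ)
    (u : Fin n → Fin n → ℝ) (t : ℕ) (k : Fin n) : Vec d × Vec d :=
  modeRun (b k) α (fun s => mode (u k) (runGrad W α β F x₀ z s)) t

/-- The correction `x - ψ` has mean zero at all times, so the mean follows plain momentum descent.
-/
theorem avg_ψ_run (hW : IsCommunicationMatrix W) (t : ℕ) :
    avg (run W α β F x₀ z t).ψ = avg (run W α β F x₀ z t).x := by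
  induction t with
  | zero => rfl
  | succ t ih =>
    simp only [run, step]
    rw [avg_mul hW, avg_sub _ (run W α β F x₀ z t).ψ, avg_add, ih, add_sub_cancel_right]

theorem mode_run_succ (hM : IsModeDecomposition W l b u) (t : ℕ) (k : Fin n) :
    mode (u k) (run W α β F x₀ z (t + 1)).x = β • mode (u k) (run W α β F x₀ z t).x
      + (1 - β) • b k • (runModes W α β F x₀ z b u (t + 1) k).1 := by
  refine mode_eq_smoothing (b := b k) (α := α) (fun t => mode (u k) (run W α β F x₀ z t).x)
    (fun t => mode (u k) (run W α β F x₀ z t).ψ) (fun t => mode (u k) (run W α β F x₀ z t).m)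
    (fun t => mode (u k) (runGrad W α β F x₀ z t)) ?_ ?_ ?_ ?_ ?_ ?_ t
  · exact hM.mode_const k x₀
  · exact hM.mode_const k x₀
  · exact hM.mode_const k 0
  · intro t
    rw [← mode_smul, ← mode_smul, ← mode_add]
    rfl
  · intro t
    rw [← mode_smul, ← mode_sub]
    rfl
  · intro t
    rw [← mode_add, ← mode_sub, ← hM.mode_mul]
    rfl

theorem lyapunov_run_succ_le (hn : 0 < n) (hW : IsCommunicationMatrix W)
    (hM : IsModeDecomposition W l b u)
    (hf : IsSmoothObjective f (fun x => avg (fun i => G i x)) c L)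
    (hG : ∀ i x y, ‖G i x - G i y‖ ≤ L * ‖x - y‖)
    (hPL : ∀ x, 2 * μ * (f x - c) ≤ ‖avg (fun i => G i x)‖ ^ 2)
    (hl₀ : 0 ≤ l) (hl₁ : l < 1) (hα : 0 < α) (hβ₀ : 0 ≤ β) (hβ₁ : β < 1) (hμ : 0 < μ)
    (hμL : μ ≤ L) (hαl : α * L ≤ (1 - √l) / 10) (hαβ : α * L ≤ (1 - β) / 5)
    (t : ℕ) (δ : Fin n → Vec d)
    (hδ : ∀ i, δ i = runGrad W α β F x₀ z t i - G i ((run W α β F x₀ z t).x i)) :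
    lyapunov b u l α β L f c G (run W α β F x₀ z (t + 1)) (runModes W α β F x₀ z b u (t + 1))
      ≤ (1 - α * μ) *
          lyapunov b u l α β L f c G (run W α β F x₀ z t) (runModes W α β F x₀ z b u t)
        + noiseTerm b u l α β L G (run W α β F x₀ z t) (runModes W α β F x₀ z b u t) δ
        + 21 / 10 * (α ^ 2 * L) * ‖avg δ‖ ^ 2
        + modeWeight l α L * (2 * α ^ 2) * ((n : ℝ)⁻¹ * ∑ i, ‖δ i‖ ^ 2) := by
  have hg : runGrad W α β F x₀ z t = fun i => G i ((run W α β F x₀ z t).x i) + δ i := by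
    ext1 i
    rw [hδ, add_sub_cancel]
  have hs : run W α β F x₀ z (t + 1) = step W α β
      (fun i => G i ((run W α β F x₀ z t).x i) + δ i) (run W α β F x₀ z t) := by
    rw [← hg]
    rfl
  rw [hs]
  refine lyapunov_step_le hn hW hM hf hG hPL hl₀ hl₁ hα hβ₀ hβ₁ hμ hμL hαl hαβ _ δ _ _ ?_
    (avg_ψ_run hW t) ?_
  · intro k
    rw [← hg]
    rfl
  · intro k
    rw [← hs]
    exact mode_run_succ hM t k

/-- Consensus error and momentum vanish initially; only the shift of `s` contributes, and by
Parseval its modes add up to the heterogeneity. -/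
theorem lyapunov_zero_le (hn : 0 < n) (hM : IsModeDecomposition W l b u) (hl₀ : 0 ≤ l)
    (hl₁ : l < 1) (hα : 0 < α) :
    lyapunov b u l α β L f c G (run W α β F x₀ z 0) (runModes W α β F x₀ z b u 0)
      ≤ f x₀ - c + modeWeight l α L * (α ^ 2 / (1 - l)) *
          ((n : ℝ)⁻¹ * ∑ i, ‖G i x₀ - avg (fun j => G j x₀)‖ ^ 2) := by
  have hX : 0 < 1 - l := sub_pos.2 hl₁
  have hK := modeWeight_nonneg (L := L) hl₀ hl₁ hα.le
  have h1 : ∑ k, modeEnergy (b k) (0 : Vec d) (0 + α • mode (u k) (fun i => G i x₀))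
      ≤ α ^ 2 / (1 - l) * ∑ i, ‖G i x₀ - avg (fun j => G j x₀)‖ ^ 2 := by
    rw [← hM.sum_sq_norm_mode, Finset.mul_sum]
    refine Finset.sum_le_sum fun k _ => ?_
    have hb := hM.le k
    have e : modeEnergy (b k) (0 : Vec d) (0 + α • mode (u k) (fun i => G i x₀))
        = α ^ 2 / (1 - b k) * ‖mode (u k) (fun i => G i x₀)‖ ^ 2 := by
      simp only [modeEnergy, norm_zero, zero_add, norm_smul, mul_pow, Real.norm_eq_abs, sq_abs]
      ring
    rw [e]
    gcongr
  have h2 : 0 ≤ ∑ k, modeEnergy (b k) (0 : Vec d) (0 + α • mode (u k) (fun i => G i x₀)) :=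
    Finset.sum_nonneg fun k _ => modeEnergy_nonneg (hM.nonneg k) ((hM.le k).trans_lt hl₁) _ _
  have h3 : 0 ≤ 4 * α * L ^ 2 * l ^ 2 / (1 + l) := by positivity
  simp only [lyapunov, run, runModes, modeRun, avg_const hn, smul_zero, sub_zero, norm_zero,
    hM.mode_const]
  simp only [ne_eq, OfNat.ofNat_ne_zero, not_false_eq_true, zero_pow, mul_zero, add_zero,
    Finset.sum_const_zero]
  refine add_le_add le_rfl ?_
  calc (modeWeight l α L - 4 * α * L ^ 2 * l ^ 2 / (1 + l)) * ((n : ℝ)⁻¹ *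
        ∑ k, modeEnergy (b k) (0 : Vec d) (0 + α • mode (u k) (fun i => G i x₀)))
      ≤ modeWeight l α L * ((n : ℝ)⁻¹ *
        (α ^ 2 / (1 - l) * ∑ i, ‖G i x₀ - avg (fun j => G j x₀)‖ ^ 2)) := by
        gcongr
        linarith
    _ = _ := by ring

theorem gap_avg_le_two_mul_lyapunov
    (hf : IsSmoothObjective f (fun x => avg (fun i => G i x)) c L)
    (hM : IsModeDecomposition W l b u) (hl₀ : 0 ≤ l) (hl₁ : l < 1) (hα : 0 < α) (hβ₀ : 0 ≤ β)
    (hβ₁ : β < 1) (S : State n d) (r : Fin n → Vec d × Vec d) :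
    f (avg S.x) - c ≤ 2 * lyapunov b u l α β L f c G S r := by
  have hL := hf.pos
  have hq : 0 < 1 - β := sub_pos.2 hβ₁
  have hX : 0 < 1 - l := sub_pos.2 hl₁
  have h1 := hf.gap_sub_le (avg S.x - (α * β / (1 - β)) • avg S.m) ((α * β / (1 - β)) • avg S.m)
  rw [sub_add_cancel, norm_smul, mul_pow, Real.norm_eq_abs, sq_abs] at h1
  have h2 : L * ((α * β / (1 - β)) ^ 2 * ‖avg S.m‖ ^ 2)
      ≤ 1 * (α ^ 2 * L / (1 - β) ^ 2 * ‖avg S.m‖ ^ 2) := by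
    calc _ = β ^ 2 * (α ^ 2 * L / (1 - β) ^ 2 * ‖avg S.m‖ ^ 2) := by field_simp
      _ ≤ _ := by
        gcongr
        exact pow_le_one₀ hβ₀ hβ₁.le
  have h3 : 0 ≤ α ^ 2 * L / (1 - β) ^ 2 * ‖avg S.m‖ ^ 2 := by positivity
  have h4 : 0 ≤ 2 * α * L ^ 2 / (1 - β) * ((n : ℝ)⁻¹ * ∑ k, ‖mode (u k) S.x‖ ^ 2) := by
    positivity
  -- The energy keeps positive weight after the subtraction.
  have h5 : 0 ≤ modeWeight l α L - 4 * α * L ^ 2 * l ^ 2 / (1 + l) := by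
    have : modeWeight l α L - 4 * α * L ^ 2 * l ^ 2 / (1 + l)
        = 4 * α * L ^ 2 * l ^ 2 / (1 + l) * ((17 + 3 * l) / (3 * (1 - l))) := by
      unfold modeWeight
      field_simp
      ring
    rw [this]
    positivity
  have h6 : 0 ≤ (n : ℝ)⁻¹ * ∑ k, modeEnergy (b k) (r k).1
      ((r k).2 + α • mode (u k) (fun i => G i (avg S.x))) :=
    mul_nonneg (by positivity) (Finset.sum_nonneg fun k _ =>
      modeEnergy_nonneg (hM.nonneg k) ((hM.le k).trans_lt hl₁) _ _)
  have h7 := mul_nonneg h5 h6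
  unfold lyapunov
  linarith

end Run
-- Adaptedness and moments of the gradient noise
section Stochastic

set_option linter.unusedSectionVars false

variable {Ω : Type*} [MeasurableSpace Ω] {P : Measure Ω} [IsProbabilityMeasure P] {n d p : ℕ}
  {W : Matrix (Fin n) (Fin n) ℝ} {b : Fin n → ℝ} {u : Fin n → Fin n → ℝ}
  {F : Fin n → Vec d → Vec p → ℝ} {D : Fin n → Measure (Vec p)} {ξ : Fin n → ℕ → Ω → Vec p}
  {x₀ : Vec d} {l α β L σ μ c : ℝ} {f : Vec d → ℝ} {fi : Fin n → Vec d → ℝ}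

/-- The data of the run at the outcome `ω`. -/
abbrev dataAt (ξ : Fin n → ℕ → Ω → Vec p) (ω : Ω) : Fin n → ℕ → Vec p := fun j s => ξ j s ω

/-- The noise `δᵢ⁽ᵗ⁾` of the stochastic gradients along the run. -/
noncomputable def gradNoise (W : Matrix (Fin n) (Fin n) ℝ) (α β : ℝ)
    (F : Fin n → Vec d → Vec p → ℝ) (x₀ : Vec d) (ξ : Fin n → ℕ → Ω → Vec p)
    (fi : Fin n → Vec d → ℝ) (t : ℕ) (i : Fin n) (ω : Ω) : Vec d :=
  stochGrad F i (iterate W α β F x₀ ξ t i ω) (ξ i t ω)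
    - gradient (fi i) (iterate W α β F x₀ ξ t i ω)

theorem past_mono (ξ : Fin n → ℕ → Ω → Vec p) {s t : ℕ} (h : s ≤ t) : past ξ s ≤ past ξ t :=
  iSup_le fun r => iSup_le fun hr =>
    le_iSup_of_le r (le_iSup_of_le (hr.trans_le h) le_rfl)

theorem IsDataStream.past_le (hξ : IsDataStream P D ξ) (t : ℕ) :
    past ξ t ≤ ‹MeasurableSpace Ω› :=
  iSup_le fun s => iSup_le fun _ => iSup_le fun i => (hξ.measurable i s).comap_le

theorem comap_le_past_succ (ξ : Fin n → ℕ → Ω → Vec p) (i : Fin n) (t : ℕ) :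
    MeasurableSpace.comap (ξ i t) inferInstance ≤ past ξ (t + 1) :=
  le_iSup_of_le t (le_iSup_of_le t.lt_succ_self (le_iSup
    (fun i => MeasurableSpace.comap (ξ i t) inferInstance) i))

theorem WellPosed.stronglyMeasurable_stochGrad (hF : WellPosed F D) {m : MeasurableSpace Ω}
    {i : Fin n} {X : Ω → Vec d} {Y : Ω → Vec p} (hX : StronglyMeasurable[m] X)
    (hY : Measurable[m] Y) : StronglyMeasurable[m] (fun ω => stochGrad F i (X ω) (Y ω)) :=
  ((hF.measurable_grad i).comp (hX.measurable.prodMk hY)).stronglyMeasurable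

/-- The state of the run and its consensus modes are functions of the past. -/
structure IsAdaptedRun (P : Measure Ω) (W : Matrix (Fin n) (Fin n) ℝ) (α β : ℝ)
    (F : Fin n → Vec d → Vec p → ℝ) (x₀ : Vec d) (ξ : Fin n → ℕ → Ω → Vec p) (b : Fin n → ℝ)
    (u : Fin n → Fin n → ℝ) (t : ℕ) : Prop where
  x : ∀ i, IsSquareAdapted (past ξ t) P fun ω => (run W α β F x₀ (dataAt ξ ω) t).x i
  ψ : ∀ i, IsSquareAdapted (past ξ t) P fun ω => (run W α β F x₀ (dataAt ξ ω) t).ψ i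
  m : ∀ i, IsSquareAdapted (past ξ t) P fun ω => (run W α β F x₀ (dataAt ξ ω) t).m i
  φ : ∀ k, IsSquareAdapted (past ξ t) P fun ω => (runModes W α β F x₀ (dataAt ξ ω) b u t k).1
  s : ∀ k, IsSquareAdapted (past ξ t) P fun ω => (runModes W α β F x₀ (dataAt ξ ω) b u t k).2

theorem isSquareAdapted_runGrad (hF : WellPosed F D)
    (hG : ∀ i x y, ‖gradient (fi i) x - gradient (fi i) y‖ ≤ L * ‖x - y‖)
    (hσ : IsUnbiasedWithVariance P F fi ξ (iterate W α β F x₀ ξ) σ) (t : ℕ) (i : Fin n)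
    (hx : IsSquareAdapted (past ξ t) P fun ω => (run W α β F x₀ (dataAt ξ ω) t).x i) :
    IsSquareAdapted (past ξ (t + 1)) P fun ω => runGrad W α β F x₀ (dataAt ξ ω) t i := by
  refine ⟨hF.stronglyMeasurable_stochGrad (hx.mono (past_mono ξ t.le_succ)).1
    ((comap_measurable (ξ i t)).mono (comap_le_past_succ ξ i t) le_rfl), ?_⟩
  -- The stochastic gradient is the square-integrable noise plus a Lipschitz function of the
  -- iterate.
  have := (hσ.memLp t i).add (hx.comp_lipschitz (hG i)).memLp
  refine this.ae_eq (ae_of_all _ fun ω => ?_)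
  simp only [Pi.add_apply, iterate, runGrad, sub_add_cancel]

theorem isAdaptedRun (hF : WellPosed F D)
    (hG : ∀ i x y, ‖gradient (fi i) x - gradient (fi i) y‖ ≤ L * ‖x - y‖)
    (hσ : IsUnbiasedWithVariance P F fi ξ (iterate W α β F x₀ ξ) σ) (t : ℕ) :
    IsAdaptedRun P W α β F x₀ ξ b u t := by
  induction t with
  | zero => exact ⟨fun _ => .const x₀, fun _ => .const x₀, fun _ => .const 0,
      fun _ => .const 0, fun _ => .const 0⟩
  | succ t ih =>
    have hle := past_mono ξ t.le_succ
    have hg := fun i => isSquareAdapted_runGrad hF hG hσ t i (ih.x i)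
    have hm : ∀ i, IsSquareAdapted (past ξ (t + 1)) P
        fun ω => (run W α β F x₀ (dataAt ξ ω) (t + 1)).m i :=
      fun i => (((ih.m i).mono hle).smul β).add ((hg i).smul (1 - β))
    have hψ : ∀ i, IsSquareAdapted (past ξ (t + 1)) P
        fun ω => (run W α β F x₀ (dataAt ξ ω) (t + 1)).ψ i :=
      fun i => ((ih.x i).mono hle).sub ((hm i).smul α)
    have hφ : ∀ k, IsSquareAdapted (past ξ (t + 1)) P
        fun ω => (runModes W α β F x₀ (dataAt ξ ω) b u (t + 1) k).1 :=
      fun k => ((((ih.φ k).mono hle).smul (b k)).sub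
        ((IsSquareAdapted.mode (u k) hg).smul α)).sub ((ih.s k).mono hle)
    refine ⟨fun i => ?_, hψ, hm, hφ, fun k => ?_⟩
    · have := fun j => (((hψ j).add ((ih.x j).mono hle)).sub ((ih.ψ j).mono hle)).smul (W i j)
      exact IsSquareAdapted.sum Finset.univ this
    · exact ((ih.s k).mono hle).add ((hφ k).smul (1 - b k))

theorem integral_inner_gradNoise (hξ : IsDataStream P D ξ)
    (hσ : IsUnbiasedWithVariance P F fi ξ (iterate W α β F x₀ ξ) σ) (t : ℕ) (i : Fin n)
    {V : Ω → Vec d} (hV : IsSquareAdapted (past ξ t) P V) :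
    ∫ ω, inner ℝ (V ω) (gradNoise W α β F x₀ ξ fi t i ω) ∂P = 0 :=
  integral_inner_eq_zero_of_condExp_eq_zero (hξ.past_le t) hV.1 hV.2 (hσ.memLp t i)
    (hσ.unbiased t i)

theorem integral_inner_mode_gradNoise (hξ : IsDataStream P D ξ)
    (hσ : IsUnbiasedWithVariance P F fi ξ (iterate W α β F x₀ ξ) σ) (t : ℕ) (a : Fin n → ℝ)
    {V : Ω → Vec d} (hV : IsSquareAdapted (past ξ t) P V) :
    Integrable (fun ω => inner ℝ (V ω) (mode a fun i => gradNoise W α β F x₀ ξ fi t i ω)) P ∧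
      ∫ ω, inner ℝ (V ω) (mode a fun i => gradNoise W α β F x₀ ξ fi t i ω) ∂P = 0 := by
  have hi : ∀ i, Integrable
      (fun ω => a i * inner ℝ (V ω) (gradNoise W α β F x₀ ξ fi t i ω)) P :=
    fun i => (hV.2.integrable_inner_real (hσ.memLp t i)).const_mul _
  simp only [mode, inner_sum, inner_smul_right]
  refine ⟨integrable_finsetSum _ fun i _ => hi i, ?_⟩
  rw [integral_finsetSum _ fun i _ => hi i]
  refine Finset.sum_eq_zero fun i _ => ?_
  rw [integral_const_mul, integral_inner_gradNoise hξ hσ t i hV, mul_zero]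

/-- The noise of agent `j` stays centered when `ξ i t` is adjoined to the past, by independence; the
noise of agent `i` is measurable for this larger σ-algebra. -/
theorem integral_inner_gradNoise_of_ne (hF : WellPosed F D)
    (hG : ∀ i x y, ‖gradient (fi i) x - gradient (fi i) y‖ ≤ L * ‖x - y‖)
    (hξ : IsDataStream P D ξ)
    (hσ : IsUnbiasedWithVariance P F fi ξ (iterate W α β F x₀ ξ) σ) (t : ℕ) {i j : Fin n}
    (hij : i ≠ j) :
    ∫ ω, inner ℝ (gradNoise W α β F x₀ ξ fi t i ω) (gradNoise W α β F x₀ ξ fi t j ω) ∂P = 0 := by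
  have hx := (isAdaptedRun (b := 0) (u := 0) hF hG hσ t).x
  have hm : ∀ (k : Fin n), StronglyMeasurable[past ξ t ⊔ MeasurableSpace.comap (ξ k t) inferInstance]
      (gradNoise W α β F x₀ ξ fi t k) := fun k => by
    have h₁ : past ξ t ≤ past ξ t ⊔ MeasurableSpace.comap (ξ k t) inferInstance := le_sup_left
    have h₂ : MeasurableSpace.comap (ξ k t) inferInstance
      ≤ past ξ t ⊔ MeasurableSpace.comap (ξ k t) inferInstance := le_sup_right
    exact (hF.stronglyMeasurable_stochGrad ((hx k).mono h₁).1
      ((comap_measurable (ξ k t)).mono h₂ le_rfl)).sub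
      (((hx k).comp_lipschitz (hG k)).mono h₁).1
  have hle : ∀ k, MeasurableSpace.comap (ξ k t) inferInstance ≤ ‹MeasurableSpace Ω› :=
    fun k => (hξ.measurable k t).comap_le
  have hind : Indep (past ξ t ⊔ MeasurableSpace.comap (ξ j t) inferInstance)
      (MeasurableSpace.comap (ξ i t) inferInstance) P := by
    have h := indep_iSup_of_disjoint
      (m := fun q : Fin n × ℕ => MeasurableSpace.comap (ξ q.1 q.2) inferInstance)
      (fun q => (hξ.measurable q.1 q.2).comap_le) hξ.indep.iIndep
      (S := {(i, t)}ᶜ) (T := {(i, t)}) disjoint_compl_left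
    have hmem : ∀ q : Fin n × ℕ, q ≠ (i, t) → MeasurableSpace.comap (ξ q.1 q.2) inferInstance
        ≤ ⨆ q ∈ ({(i, t)}ᶜ : Set (Fin n × ℕ)),
          MeasurableSpace.comap (ξ q.1 q.2) inferInstance := fun q hq =>
      le_iSup₂ (f := fun (q : Fin n × ℕ) (_ : q ∈ ({(i, t)}ᶜ : Set (Fin n × ℕ))) =>
        MeasurableSpace.comap (ξ q.1 q.2) inferInstance) q hq
    refine indep_of_indep_of_le_left (indep_of_indep_of_le_right h ?_) ?_
    · exact le_iSup₂ (f := fun (q : Fin n × ℕ) (_ : q ∈ ({(i, t)} : Set (Fin n × ℕ))) =>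
        MeasurableSpace.comap (ξ q.1 q.2) inferInstance) (i, t) rfl
    · refine sup_le (iSup_le fun s => iSup_le fun hs => iSup_le fun k => ?_) ?_
      · exact hmem (k, s) fun h => hs.ne (congrArg Prod.snd h)
      · exact hmem (j, t) fun h => hij (congrArg Prod.fst h).symm
  exact integral_inner_eq_zero_of_condExp_eq_zero (sup_le (hξ.past_le t) (hle i)) (hm i)
    (hσ.memLp t i) (hσ.memLp t j) (condExp_sup_eq_zero (hξ.past_le t)
      (sup_le (hξ.past_le t) (hle j)) (hle i) le_sup_left (hm j)
      ((hσ.memLp t j).integrable one_le_two) (hσ.unbiased t j) hind)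

theorem integral_sq_norm_gradNoise_le (hξ : IsDataStream P D ξ)
    (hσ : IsUnbiasedWithVariance P F fi ξ (iterate W α β F x₀ ξ) σ) (t : ℕ) (i : Fin n) :
    ∫ ω, ‖gradNoise W α β F x₀ ξ fi t i ω‖ ^ 2 ∂P ≤ σ ^ 2 := by
  rw [← integral_condExp (hξ.past_le t)]
  refine (integral_mono_ae integrable_condExp (integrable_const _) (hσ.variance_le t i)).trans ?_
  simp

theorem integrable_sq_norm_gradNoise
    (hσ : IsUnbiasedWithVariance P F fi ξ (iterate W α β F x₀ ξ) σ) (t : ℕ) (i : Fin n) :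
    Integrable (fun ω => ‖gradNoise W α β F x₀ ξ fi t i ω‖ ^ 2) P :=
  (hσ.memLp t i).integrable_norm_pow two_ne_zero

/-- Cross terms vanish, leaving `n` variances divided by `n²`. -/
theorem integral_sq_norm_avg_gradNoise_le (hn : 0 < n) (hF : WellPosed F D)
    (hG : ∀ i x y, ‖gradient (fi i) x - gradient (fi i) y‖ ≤ L * ‖x - y‖)
    (hξ : IsDataStream P D ξ)
    (hσ : IsUnbiasedWithVariance P F fi ξ (iterate W α β F x₀ ξ) σ) (t : ℕ) :
    ∫ ω, ‖avg fun i => gradNoise W α β F x₀ ξ fi t i ω‖ ^ 2 ∂P ≤ σ ^ 2 / n := by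
  have hn' : (0 : ℝ) < n := by positivity
  have hi : ∀ i j, Integrable (fun ω => inner ℝ (gradNoise W α β F x₀ ξ fi t i ω)
      (gradNoise W α β F x₀ ξ fi t j ω)) P :=
    fun i j => (hσ.memLp t i).integrable_inner_real (hσ.memLp t j)
  have e : ∀ ω, ‖avg fun i => gradNoise W α β F x₀ ξ fi t i ω‖ ^ 2
      = (n : ℝ)⁻¹ ^ 2 * ∑ i, ∑ j, inner ℝ (gradNoise W α β F x₀ ξ fi t i ω)
        (gradNoise W α β F x₀ ξ fi t j ω) := fun ω => by
    rw [avg, norm_smul, mul_pow, Real.norm_eq_abs, sq_abs, ← real_inner_self_eq_norm_sq, sum_inner]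
    simp only [inner_sum]
  simp only [e]
  rw [integral_const_mul, integral_finsetSum _ fun i _ => integrable_finsetSum _ fun j _ => hi i j]
  have h1 : ∀ i, ∫ ω, ∑ j, inner ℝ (gradNoise W α β F x₀ ξ fi t i ω)
      (gradNoise W α β F x₀ ξ fi t j ω) ∂P ≤ σ ^ 2 := fun i => by
    rw [integral_finsetSum _ fun j _ => hi i j, Finset.sum_eq_single i
      (fun j _ hj => integral_inner_gradNoise_of_ne hF hG hξ hσ t hj.symm) (by simp)]
    simp only [real_inner_self_eq_norm_sq]
    exact integral_sq_norm_gradNoise_le hξ hσ t i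
  calc (n : ℝ)⁻¹ ^ 2 * ∑ i, ∫ ω, ∑ j, inner ℝ (gradNoise W α β F x₀ ξ fi t i ω)
        (gradNoise W α β F x₀ ξ fi t j ω) ∂P ≤ (n : ℝ)⁻¹ ^ 2 * ∑ _i : Fin n, σ ^ 2 := by
        gcongr with i
        exact h1 i
    _ = σ ^ 2 / n := by
      simp only [Finset.sum_const, Finset.card_univ, Fintype.card_fin, nsmul_eq_mul]
      field_simp

theorem IsSmoothObjective.integrable_comp {G : Vec d → Vec d} (hf : IsSmoothObjective f G c L)
    (hfc : Continuous f) {m : MeasurableSpace Ω} {X : Ω → Vec d} (hX : IsSquareAdapted m P X) :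
    Integrable (fun ω => f (X ω)) P := by
  have h1 : Integrable (fun ω => f (X ω) - c) P := by
    refine ((integrable_const (2 * (f 0 - c))).add (hX.integrable_sq_norm.const_mul L)).mono'
      ((hfc.comp_aestronglyMeasurable hX.2.1).sub aestronglyMeasurable_const) ?_
    refine ae_of_all _ fun ω => ?_
    rw [Real.norm_of_nonneg (sub_nonneg.2 (hf.le _))]
    simpa using hf.gap_sub_le 0 (X ω)
  refine (h1.add (integrable_const c)).congr (ae_of_all _ fun ω => ?_)
  simp

theorem integral_noiseTerm (hξ : IsDataStream P D ξ) (hF : WellPosed F D)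
    (hG : ∀ i x y, ‖gradient (fi i) x - gradient (fi i) y‖ ≤ L * ‖x - y‖)
    (hGa : ∀ x y, ‖avg (fun i => gradient (fi i) x) - avg (fun i => gradient (fi i) y)‖
      ≤ L * ‖x - y‖)
    (hσ : IsUnbiasedWithVariance P F fi ξ (iterate W α β F x₀ ξ) σ) (t : ℕ) :
    Integrable (fun ω => noiseTerm b u l α β L (fun i => gradient (fi i))
        (run W α β F x₀ (dataAt ξ ω) t) (runModes W α β F x₀ (dataAt ξ ω) b u t)
        (fun i => gradNoise W α β F x₀ ξ fi t i ω)) P ∧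
      ∫ ω, noiseTerm b u l α β L (fun i => gradient (fi i))
        (run W α β F x₀ (dataAt ξ ω) t) (runModes W α β F x₀ (dataAt ξ ω) b u t)
        (fun i => gradNoise W α β F x₀ ξ fi t i ω) ∂P = 0 := by
  have ha := isAdaptedRun (b := b) (u := u) hF hG hσ t
  have hx := IsSquareAdapted.avg ha.x
  have hm := IsSquareAdapted.avg ha.m
  have hGx := fun i => (ha.x i).comp_lipschitz (hG i)
  have hg := IsSquareAdapted.avg hGx
  have hγ := fun i => hx.comp_lipschitz (hG i)
  obtain ⟨i1, e1⟩ := integral_inner_mode_gradNoise (fi := fi) hξ hσ t (fun _ => (n : ℝ)⁻¹)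
    (((((hx.sub (hm.smul (α * β / (1 - β)))).comp_lipschitz hGa).smul α).neg.add
      (hg.smul (α ^ 2 * L))).add
      (((hm.smul β).add (hg.smul (1 - β))).smul (2 * (α ^ 2 * L / (1 - β) ^ 2
        + modeWeight l α L * (9 / (1 - l) ^ 2 * (α ^ 4 * L ^ 2))) * (1 - β))))
  have hk := fun k => by
    have hs := (ha.s k).add ((IsSquareAdapted.mode (u k) hγ).smul α)
    have hw := ((ha.φ k).smul (b k)).sub
      ((IsSquareAdapted.mode (u k) fun i => (hGx i).sub (hγ i)).smul α)
    exact integral_inner_mode_gradNoise (fi := fi) hξ hσ t (u k)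
      ((((hw.add ((hw.sub hs).smul ((1 - b k) / 2))).smul (-(2 * α))).smul (1 + (1 - l) / 8)))
  have i2 := ((integrable_finsetSum Finset.univ fun k _ => (hk k).1).const_mul
    (n : ℝ)⁻¹).const_mul (modeWeight l α L)
  have e : ∀ X : Fin n → Vec d, avg X = mode (fun _ => (n : ℝ)⁻¹) X := fun X => by
    simp [avg, mode, Finset.smul_sum]
  unfold noiseTerm
  conv => enter [1, 1, ω, 1, 3]; rw [e]
  conv => enter [2, 1, 2, ω, 1, 3]; rw [e]
  refine ⟨i1.add i2, ?_⟩
  refine (integral_add i1 i2).trans ?_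
  rw [e1, integral_const_mul, integral_const_mul, integral_finsetSum _ fun k _ => (hk k).1,
    Finset.sum_eq_zero fun k _ => (hk k).2]
  simp

end Stochastic
-- Expected recursion and comparison of constants
section Convergence

variable {Ω : Type*} [MeasurableSpace Ω] {P : Measure Ω} [IsProbabilityMeasure P] {n d p : ℕ}
  {W : Matrix (Fin n) (Fin n) ℝ} {b : Fin n → ℝ} {u : Fin n → Fin n → ℝ}
  {F : Fin n → Vec d → Vec p → ℝ} {D : Fin n → Measure (Vec p)} {ξ : Fin n → ℕ → Ω → Vec p}
  {x₀ : Vec d} {l α β L σ μ c : ℝ} {f : Vec d → ℝ} {fi : Fin n → Vec d → ℝ}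

theorem integrable_lyapunov (hfc : Continuous f)
    (hf : IsSmoothObjective f (fun x => avg (fun i => gradient (fi i) x)) c L)
    (hF : WellPosed F D)
    (hG : ∀ i x y, ‖gradient (fi i) x - gradient (fi i) y‖ ≤ L * ‖x - y‖)
    (hσ : IsUnbiasedWithVariance P F fi ξ (iterate W α β F x₀ ξ) σ) (t : ℕ) :
    Integrable (fun ω => lyapunov b u l α β L f c (fun i => gradient (fi i))
      (run W α β F x₀ (dataAt ξ ω) t) (runModes W α β F x₀ (dataAt ξ ω) b u t)) P := by
  have ha := isAdaptedRun (b := b) (u := u) hF hG hσ t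
  have hx := IsSquareAdapted.avg ha.x
  have hm := IsSquareAdapted.avg ha.m
  have hγ := fun i => hx.comp_lipschitz (hG i)
  refine ((((hf.integrable_comp hfc (hx.sub (hm.smul (α * β / (1 - β))))).sub
    (integrable_const c)).add (hm.integrable_sq_norm.const_mul _)).add
    (((integrable_finsetSum Finset.univ fun k _ =>
      (IsSquareAdapted.mode (u k) ha.x).integrable_sq_norm).const_mul _).const_mul _)).add
    (((integrable_finsetSum Finset.univ fun k _ => ?_).const_mul _).const_mul _)
  exact ((ha.φ k).integrable_sq_norm.const_mul _).add
    (((ha.s k).add ((IsSquareAdapted.mode (u k) hγ).smul α)).integrable_sq_norm.div_const _)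

theorem integral_lyapunov_succ_le (hn : 0 < n) (hW : IsCommunicationMatrix W)
    (hM : IsModeDecomposition W l b u) (hfc : Continuous f)
    (hf : IsSmoothObjective f (fun x => avg (fun i => gradient (fi i) x)) c L)
    (hG : ∀ i x y, ‖gradient (fi i) x - gradient (fi i) y‖ ≤ L * ‖x - y‖)
    (hPL : ∀ x, 2 * μ * (f x - c) ≤ ‖avg (fun i => gradient (fi i) x)‖ ^ 2)
    (hl₀ : 0 ≤ l) (hl₁ : l < 1) (hα : 0 < α) (hβ₀ : 0 ≤ β) (hβ₁ : β < 1) (hμ : 0 < μ)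
    (hμL : μ ≤ L) (hαl : α * L ≤ (1 - √l) / 10) (hαβ : α * L ≤ (1 - β) / 5)
    (hF : WellPosed F D) (hξ : IsDataStream P D ξ)
    (hσ : IsUnbiasedWithVariance P F fi ξ (iterate W α β F x₀ ξ) σ) (t : ℕ) :
    ∫ ω, lyapunov b u l α β L f c (fun i => gradient (fi i))
        (run W α β F x₀ (dataAt ξ ω) (t + 1)) (runModes W α β F x₀ (dataAt ξ ω) b u (t + 1)) ∂P
      ≤ (1 - α * μ) * ∫ ω, lyapunov b u l α β L f c (fun i => gradient (fi i))
        (run W α β F x₀ (dataAt ξ ω) t) (runModes W α β F x₀ (dataAt ξ ω) b u t) ∂P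
        + (21 / 10 * (α ^ 2 * L) * (σ ^ 2 / n) + modeWeight l α L * (2 * α ^ 2) * σ ^ 2) := by
  have hn' : (0 : ℝ) < n := by positivity
  have hL := hf.pos
  have hK := modeWeight_nonneg (L := L) hl₀ hl₁ hα.le
  have hV := fun t => integrable_lyapunov (b := b) (u := u) (l := l) hfc hf hF hG hσ t
  obtain ⟨i1, e1⟩ := integral_noiseTerm (b := b) (u := u) (l := l) hξ hF hG hf.lipschitz hσ t
  have i2 : Integrable (fun ω => ‖avg fun i => gradNoise W α β F x₀ ξ fi t i ω‖ ^ 2) P :=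
    ((memLp_finsetSum Finset.univ fun i _ => hσ.memLp t i).const_smul
      (n : ℝ)⁻¹).integrable_norm_pow two_ne_zero
  have i3 : Integrable (fun ω => ∑ i, ‖gradNoise W α β F x₀ ξ fi t i ω‖ ^ 2) P :=
    integrable_finsetSum _ fun i _ => integrable_sq_norm_gradNoise hσ t i
  have h := integral_mono (hV (t + 1)) (((((hV t).const_mul (1 - α * μ)).add i1).add
    (i2.const_mul (21 / 10 * (α ^ 2 * L)))).add
    ((i3.const_mul (n : ℝ)⁻¹).const_mul (modeWeight l α L * (2 * α ^ 2)))) fun ω =>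
      lyapunov_run_succ_le hn hW hM hf hG hPL hl₀ hl₁ hα hβ₀ hβ₁ hμ hμL hαl hαβ t
        (fun i => gradNoise W α β F x₀ ξ fi t i ω) fun i => rfl
  refine h.trans ?_
  rw [integral_add' ((((hV t).const_mul (1 - α * μ)).add i1).add
      (i2.const_mul (21 / 10 * (α ^ 2 * L))))
      ((i3.const_mul (n : ℝ)⁻¹).const_mul (modeWeight l α L * (2 * α ^ 2))),
    integral_add' (((hV t).const_mul (1 - α * μ)).add i1) (i2.const_mul (21 / 10 * (α ^ 2 * L))),
    integral_add' ((hV t).const_mul (1 - α * μ)) i1, e1, integral_const_mul, integral_const_mul,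
    integral_const_mul, integral_const_mul,
    integral_finsetSum _ fun i _ => integrable_sq_norm_gradNoise hσ t i, add_zero, add_assoc]
  have h1 := integral_sq_norm_avg_gradNoise_le hn hF hG hξ hσ t
  have h2 : (n : ℝ)⁻¹ * ∑ i, ∫ ω, ‖gradNoise W α β F x₀ ξ fi t i ω‖ ^ 2 ∂P ≤ σ ^ 2 := by
    calc _ ≤ (n : ℝ)⁻¹ * ∑ _i : Fin n, σ ^ 2 := by
          gcongr with i
          exact integral_sq_norm_gradNoise_le hξ hσ t i
      _ = _ := by
        simp only [Finset.sum_const, Finset.card_univ, Fintype.card_fin, nsmul_eq_mul]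
        field_simp
  gcongr

theorem le_geometric_add_of_succ_le {v : ℕ → ℝ} {κ C : ℝ} (hκ₀ : 0 < κ) (hκ₁ : κ ≤ 1)
    (hC : 0 ≤ C) (h : ∀ t, v (t + 1) ≤ (1 - κ) * v t + C) (t : ℕ) :
    v t ≤ (1 - κ) ^ t * v 0 + C / κ := by
  induction t with
  | zero =>
    have : 0 ≤ C / κ := by positivity
    simpa using this
  | succ t ih =>
    calc v (t + 1) ≤ (1 - κ) * v t + C := h t
      _ ≤ (1 - κ) * ((1 - κ) ^ t * v 0 + C / κ) + C := by
        gcongr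
      _ = _ := by
        field_simp
        ring

/-- The first term of `constD₁` suffices for `β ≥ 1/2`, the second for `β ≤ 1/2`. -/
theorem constD₁_ge (hl₀ : 0 ≤ l) (hl₁ : l < 1) (hβ₁ : β < 1) :
    20 / 3 * l ≤ constD₁ l β := by
  obtain ⟨h0, h1, h2⟩ := sqrt_facts hl₀ hl₁
  have hq : 0 < 1 - β := sub_pos.2 hβ₁
  have hs : 0 < 1 - √l := sub_pos.2 h1
  have t1 : 0 ≤ 50 * l * β ^ 2 / (3 * (1 - β)) := by positivity
  have t2 : 0 ≤ 320 * (1 - β) ^ 2 / (3 * (1 + √l)) := by positivity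
  have t3 : 0 ≤ 160 / 3 * l * β ^ 2 * (1 - √l) := by positivity
  unfold constD₁
  rcases le_total (1 / 2) β with h | h
  · have : 20 / 3 * l ≤ 50 * l * β ^ 2 / (3 * (1 - β)) := by
      rw [le_div_iff₀ (by positivity)]
      have h3 : 20 * (1 - β) ≤ 50 * β ^ 2 := by nlinarith
      nlinarith [mul_le_mul_of_nonneg_left h3 hl₀]
    linarith
  · have : 20 / 3 * l ≤ 320 * (1 - β) ^ 2 / (3 * (1 + √l)) := by
      rw [le_div_iff₀ (by positivity)]
      have h3 : 1 / 4 ≤ (1 - β) ^ 2 := by nlinarith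
      nlinarith
    linarith

theorem constD₂_nonneg (hl₀ : 0 ≤ l) (hl₁ : l < 1) (hβ₁ : β < 1) : 0 ≤ constD₂ l β := by
  have hq : 0 < 1 - β := sub_pos.2 hβ₁
  have hX : 0 < 1 - l := sub_pos.2 hl₁
  unfold constD₂
  positivity

theorem modeWeight_heterogeneity_le (hl₀ : 0 ≤ l) (hl₁ : l < 1) (hα : 0 < α)
    (hβ₁ : β < 1) :
    2 * (modeWeight l α L * (α ^ 2 / (1 - l))) ≤ constD₁ l β * α ^ 3 * L ^ 2 / (1 - √l) ^ 2 := by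
  obtain ⟨h0, h1, h2⟩ := sqrt_facts hl₀ hl₁
  have hs : 0 < 1 - √l := sub_pos.2 h1
  have hX : 0 < 1 - l := sub_pos.2 hl₁
  have e : 2 * (modeWeight l α L * (α ^ 2 / (1 - l)))
      = 160 / 3 * (l ^ 2 / ((1 + l) * (1 + √l) ^ 2)) * α ^ 3 * L ^ 2 / (1 - √l) ^ 2 := by
    have hX2 : 1 - l = (1 - √l) * (1 + √l) := by nth_rw 1 [h2]; ring
    unfold modeWeight
    rw [hX2]
    field_simp
    ring
  -- By AM-GM, `2√l ≤ 1 + l` and `4√l ≤ (1 + √l)²`.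
  have h3 : l ^ 2 / ((1 + l) * (1 + √l) ^ 2) ≤ l / 8 := by
    rw [div_le_div_iff₀ (by positivity) (by norm_num)]
    have h4 : 2 * √l ≤ 1 + l := by nlinarith [sq_nonneg (1 - √l)]
    have h5 : 4 * √l ≤ (1 + √l) ^ 2 := by nlinarith [sq_nonneg (1 - √l)]
    have h6 := mul_le_mul h4 h5 (by positivity) (by positivity)
    have h7 : 8 * l ≤ (1 + l) * (1 + √l) ^ 2 := by nlinarith
    nlinarith [mul_le_mul_of_nonneg_left h7 hl₀]
  have h4 : 160 / 3 * (l ^ 2 / ((1 + l) * (1 + √l) ^ 2)) ≤ constD₁ l β := by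
    linarith [constD₁_ge hl₀ hl₁ hβ₁]
  rw [e]
  gcongr

theorem modeWeight_noise_le (hl₀ : 0 ≤ l) (hl₁ : l < 1) (hα : 0 < α) (hμ : 0 < μ) :
    2 * (modeWeight l α L * (2 * α ^ 2) * σ ^ 2 / (α * μ))
      ≤ 169 * α ^ 2 * L ^ 2 * l ^ 2 * σ ^ 2 / (μ * (1 - l)) := by
  have hX : 0 < 1 - l := sub_pos.2 hl₁
  have e : 2 * (modeWeight l α L * (2 * α ^ 2) * σ ^ 2 / (α * μ))
      = 320 / 3 / (1 + l) * (α ^ 2 * L ^ 2 * l ^ 2 * σ ^ 2 / (μ * (1 - l))) := by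
    unfold modeWeight
    field_simp
    ring
  have h : 320 / 3 / (1 + l) ≤ 169 := by
    rw [div_le_iff₀ (by linarith)]
    linarith
  rw [e, show 169 * α ^ 2 * L ^ 2 * l ^ 2 * σ ^ 2 / (μ * (1 - l))
    = 169 * (α ^ 2 * L ^ 2 * l ^ 2 * σ ^ 2 / (μ * (1 - l))) by ring]
  gcongr

/-- The Polyak–Łojasiewicz constant of a nonconstant smooth objective is at most `L`. -/
theorem IsSmoothObjective.le_of_polyakLojasiewicz {G : Vec d → Vec d}
    (hf : IsSmoothObjective f G c L) (hPL : ∀ x, 2 * μ * (f x - c) ≤ ‖G x‖ ^ 2) {x : Vec d}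
    (hx : f x ≠ c) : μ ≤ L := by
  have h1 := (hPL x).trans (hf.sq_norm_gradient_le x)
  have h2 : 0 < f x - c := sub_pos.2 (lt_of_le_of_ne (hf.le x) hx.symm)
  have := le_of_mul_le_mul_right h1 h2
  linarith

theorem rate₂_mem (hl₀ : 0 ≤ l) (hl₁ : l < 1) (hβ₁ : β < 1) :
    rate₂ l β ∈ Set.Ico (0 : ℝ) 1 := by
  obtain ⟨h0, h1, -⟩ := sqrt_facts hl₀ hl₁
  have h3 : 0 < min ((1 - √l) / 5) (2 * (1 - β) / 5) := lt_min (by linarith) (by linarith)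
  have h4 := min_le_left ((1 - √l) / 5) (2 * (1 - β) / 5)
  unfold rate₂
  constructor <;> linarith

end Convergence
end EDM

/-! ### The convergence theorem -/

theorem theorem2 {Ω : Type*} [MeasurableSpace Ω] (P : MeasureTheory.Measure Ω)
    [MeasureTheory.IsProbabilityMeasure P] {n d p : ℕ} (hn : 0 < n)
    (W : Matrix (Fin n) (Fin n) ℝ)
    (F : Fin n → EDM.Vec d → EDM.Vec p → ℝ) (D : Fin n → MeasureTheory.Measure (EDM.Vec p))
    (ξ : Fin n → ℕ → Ω → EDM.Vec p) (x₀ : EDM.Vec d) (α β L σ μ : ℝ)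
    (hα : 0 < α) (hβ₀ : 0 ≤ β) (hβ₁ : β < 1) (hL : 0 < L) (hμ : 0 < μ)
    (hF : EDM.WellPosed F D)
    (hW : EDM.IsCommunicationMatrix W)
    (hf : EDM.IsSmoothFamily (EDM.localObj F D) L)
    (hξ : EDM.IsDataStream P D ξ)
    (hσ : EDM.IsUnbiasedWithVariance P F (EDM.localObj F D) ξ (EDM.iterate W α β F x₀ ξ) σ)
    (hPL : EDM.PLCondition (EDM.globalObj (EDM.localObj F D)) μ)
    -- automatic unless `f` is constant, when every `μ` satisfies the PL condition
    (hαμ : α * μ ≤ 1)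
    (hstep : α ≤ min ((1 - √(EDM.mixingRate W)) / (10 * L)) ((1 - β) / (5 * L))) :
    EDM.rate₁ α μ ∈ Set.Ico (0 : ℝ) 1 ∧
    EDM.rate₂ (EDM.mixingRate W) β ∈ Set.Ico (0 : ℝ) 1 ∧
    ∀ t : ℕ,
      MeasureTheory.Integrable
        (fun ω => EDM.gap (EDM.globalObj (EDM.localObj F D))
          (EDM.avg fun i => EDM.iterate W α β F x₀ ξ t i ω)) P ∧
      ∫ ω, EDM.gap (EDM.globalObj (EDM.localObj F D))
          (EDM.avg fun i => EDM.iterate W α β F x₀ ξ t i ω) ∂P ≤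
        (9 * EDM.gap (EDM.globalObj (EDM.localObj F D)) x₀
            + EDM.constD₁ (EDM.mixingRate W) β * α ^ 3 * L ^ 2
                * EDM.heterogeneitySq (EDM.localObj F D) x₀
              / (1 - √(EDM.mixingRate W)) ^ 2) * EDM.rate₁ α μ ^ t
          + EDM.constD₂ (EDM.mixingRate W) β * α ^ 2 * L
                * EDM.heterogeneitySq (EDM.localObj F D) x₀
              / (1 - EDM.mixingRate W) * EDM.rate₂ (EDM.mixingRate W) β ^ t
          + 6 * α * L * σ ^ 2 / (n * μ)
          + 169 * α ^ 2 * L ^ 2 * EDM.mixingRate W ^ 2 * σ ^ 2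
              / (μ * (1 - EDM.mixingRate W)) := by
  have hn' : (0 : ℝ) < n := by positivity
  obtain ⟨b, u, hM⟩ := EDM.exists_isModeDecomposition hn hW
  have hl₀ : 0 ≤ EDM.mixingRate W := norm_nonneg _
  set l := EDM.mixingRate W
  obtain ⟨hs1, hs2⟩ := le_min_iff.1 hstep
  rw [le_div_iff₀ (by positivity)] at hs1 hs2
  have hαl : α * L ≤ (1 - √l) / 10 := by linarith
  have hαβ : α * L ≤ (1 - β) / 5 := by linarith
  have hαL : 0 < α * L := by positivity
  -- A positive step size forces `√l < 1`, so the network mixes.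
  have hl₁ : l < 1 := (Real.sqrt_lt' one_pos).1 (by linarith) |>.trans_eq (one_pow 2)
  have hαμ₀ : 0 < α * μ := by positivity
  have hρ₁ : EDM.rate₁ α μ ∈ Set.Ico (0 : ℝ) 1 := by
    unfold EDM.rate₁
    constructor <;> linarith
  have hρ₂ := EDM.rate₂_mem hl₀ hl₁ hβ₁
  refine ⟨hρ₁, hρ₂, fun t => ?_⟩
  have hX : 0 < 1 - l := sub_pos.2 hl₁
  have hD₁ : 0 ≤ EDM.constD₁ l β :=
    le_trans (by positivity) (EDM.constD₁_ge hl₀ hl₁ hβ₁)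
  have hD₂ := EDM.constD₂_nonneg hl₀ hl₁ hβ₁
  set ζ := EDM.heterogeneitySq (EDM.localObj F D) x₀ with hζ
  have hζ₀ : 0 ≤ ζ := by
    rw [hζ, EDM.heterogeneitySq]
    positivity
  set f := EDM.globalObj (EDM.localObj F D)
  have hS := hf.isSmoothObjective hn hL
  have hgrad := EDM.hasGradientAt_globalObj hf.differentiable
  have hfc : Continuous f :=
    (show Differentiable ℝ f from fun x => (hgrad x).differentiableAt).continuous
  have hPL' : ∀ x, 2 * μ * (f x - EDM.optValue f)
      ≤ ‖EDM.avg fun i => gradient (EDM.localObj F D i) x‖ ^ 2 := fun x => by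
    rw [← (hgrad x).gradient]
    exact hPL x
  have hx := EDM.IsSquareAdapted.avg
    (EDM.isAdaptedRun (b := b) (u := u) hF hf.lipschitz hσ t).x
  have hint : MeasureTheory.Integrable
      (fun ω => EDM.gap f (EDM.avg fun i => EDM.iterate W α β F x₀ ξ t i ω)) P :=
    (hS.integrable_comp hfc hx).sub (MeasureTheory.integrable_const _)
  refine ⟨hint, ?_⟩
  have hgap₀ : 0 ≤ EDM.gap f x₀ := sub_nonneg.2 (hS.le x₀)
  have p1 : 0 ≤ EDM.constD₂ l β * α ^ 2 * L * ζ / (1 - l) * EDM.rate₂ l β ^ t :=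
    mul_nonneg (by positivity) (pow_nonneg hρ₂.1 t)
  have p2 : 0 ≤ 6 * α * L * σ ^ 2 / (n * μ) := by positivity
  have p3 : 0 ≤ 169 * α ^ 2 * L ^ 2 * l ^ 2 * σ ^ 2 / (μ * (1 - l)) := by positivity
  -- If `f` is constant the gap vanishes; otherwise the PL inequality gives `μ ≤ L`, which the
  -- contraction needs.
  by_cases hconst : ∀ x, f x = EDM.optValue f
  · have h0 : ∀ x, EDM.gap f x = 0 := fun x => sub_eq_zero.2 (hconst x)
    have p4 : 0 ≤ (9 * EDM.gap f x₀ + EDM.constD₁ l β * α ^ 3 * L ^ 2 * ζ / (1 - √l) ^ 2)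
        * EDM.rate₁ α μ ^ t := mul_nonneg (by positivity) (pow_nonneg hρ₁.1 t)
    simp only [h0, MeasureTheory.integral_zero] at p4 ⊢
    linarith
  push Not at hconst
  obtain ⟨y, hy⟩ := hconst
  have hμL := hS.le_of_polyakLojasiewicz hPL' hy
  have hC : 0 ≤ 21 / 10 * (α ^ 2 * L) * (σ ^ 2 / n)
      + EDM.modeWeight l α L * (2 * α ^ 2) * σ ^ 2 := by
    have := EDM.modeWeight_nonneg (L := L) hl₀ hl₁ hα.le
    positivity
  have hrec := EDM.le_geometric_add_of_succ_le hαμ₀ hαμ hC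
    (v := fun t => ∫ ω, EDM.lyapunov b u l α β L f (EDM.optValue f)
      (fun i => gradient (EDM.localObj F D i)) (EDM.run W α β F x₀ (EDM.dataAt ξ ω) t)
      (EDM.runModes W α β F x₀ (EDM.dataAt ξ ω) b u t) ∂P)
    (EDM.integral_lyapunov_succ_le hn hW hM hfc hS hf.lipschitz hPL' hl₀ hl₁ hα hβ₀ hβ₁ hμ hμL
      hαl hαβ hF hξ hσ) t
  have hV₀ := MeasureTheory.integral_mono
    (EDM.integrable_lyapunov (b := b) (u := u) (l := l) hfc hS hF hf.lipschitz hσ 0)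
    (MeasureTheory.integrable_const _) fun ω =>
      EDM.lyapunov_zero_le (β := β) (L := L) (f := f) (c := EDM.optValue f) (F := F) (W := W)
        (x₀ := x₀) (z := EDM.dataAt ξ ω) (G := fun i => gradient (EDM.localObj F D i)) hn hM
        hl₀ hl₁ hα
  rw [MeasureTheory.integral_const, MeasureTheory.probReal_univ, one_smul] at hV₀
  have hV := (MeasureTheory.integral_mono hint
    ((EDM.integrable_lyapunov (b := b) (u := u) (l := l) hfc hS hF hf.lipschitz hσ t).const_mul 2)
    fun ω => EDM.gap_avg_le_two_mul_lyapunov hS hM hl₀ hl₁ hα hβ₀ hβ₁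
      (EDM.run W α β F x₀ (EDM.dataAt ξ ω) t) (EDM.runModes W α β F x₀ (EDM.dataAt ξ ω) b u t))
  rw [MeasureTheory.integral_const_mul] at hV
  have hpow : 0 ≤ (1 - α * μ) ^ t := pow_nonneg hρ₁.1 t
  have q1 := mul_le_mul_of_nonneg_left hV₀ hpow
  have q2 := mul_le_mul_of_nonneg_right
    (EDM.modeWeight_heterogeneity_le (L := L) hl₀ hl₁ hα hβ₁) hζ₀
  have q3 := mul_le_mul_of_nonneg_left q2 hpow
  have q4 := EDM.modeWeight_noise_le (L := L) (σ := σ) hl₀ hl₁ hα hμ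
  have q5 : 2 * (21 / 10 * (α ^ 2 * L) * (σ ^ 2 / n) / (α * μ))
      ≤ 6 * α * L * σ ^ 2 / (n * μ) := by
    have e : 2 * (21 / 10 * (α ^ 2 * L) * (σ ^ 2 / n) / (α * μ))
        = 7 / 10 * (6 * α * L * σ ^ 2 / (n * μ)) := by
      field_simp
      ring
    linarith
  have q6 : (1 - α * μ) ^ t * EDM.gap f x₀ * 2 ≤ (1 - α * μ) ^ t * EDM.gap f x₀ * 9 := by
    have := mul_nonneg hpow hgap₀
    linarith
  have e1 : EDM.constD₁ l β * α ^ 3 * L ^ 2 / (1 - √l) ^ 2 * ζ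
      = EDM.constD₁ l β * α ^ 3 * L ^ 2 * ζ / (1 - √l) ^ 2 := by ring
  rw [e1] at q3
  rw [add_div] at hrec
  change (1 - α * μ) ^ t * _ ≤ (1 - α * μ) ^ t * (EDM.gap f x₀ + _ * ζ) at q1
  unfold EDM.rate₁
  linarith
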